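/- All digraphs here are without loops and contain at most one of the arcs $(x,y)$, $(y,x)$ for any two vertices $x,y$; no finiteness is assumed. Connectedness and the chromatic number of a digraph are those of its underlying graph. Let $p_4$ be the antidirected path of length $4$ with vertices $x,y,z,v,w$ and arcs $(y,x),(y,z),(v,z),(v,w)$, and let $T_5$ be the regular $5$-tournament, i.e. the (up to isomorphism unique) tournament on five vertices in which every vertex has out-degree $2$ and in-degree $2$. **Theorem.** Let $D$ be a connected digraph with chromatic number exactly $5$, not isomorphic to $T_5$, in which every vertex has out-degree at least two. Then $D$ contains a copy of $p_4$, i.e. there is an injective map $f$ from the vertices of $p_4$ to the vertices of $D$ such that $(f(a),f(b))$ is an arc of $D$ whenever $(a,b)$ is an arc of $p_4$. -/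

import Mathlib

namespace Digraph

variable {V W : Type*}

/-- In the convention used here a digraph has no loops and at most one of the arcs `(x, y)`,
`(y, x)`: if `(x, y)` is an arc then `(y, x)` is not. (Taking `x = y` excludes loops.) -/
def IsOriented (D : Digraph V) : Prop :=
  ∀ x y, D.Adj x y → ¬ D.Adj y x

/-- The underlying graph `G(D)`: distinct `x`, `y` are joined iff `x → y` or `y → x`. -/
abbrev underlying (D : Digraph V) : SimpleGraph V :=
  D.toSimpleGraphInclusive

/-- The out-neighbourhood `N⁺(v)`. -/
def outNeighbors (D : Digraph V) (v : V) : Set V :=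
  {w | D.Adj v w}

/-- The in-neighbourhood `N⁻(v)`. -/
def inNeighbors (D : Digraph V) (v : V) : Set V :=
  {w | D.Adj w v}

/-- The out-degree `d⁺(v)`, as an extended natural number. -/
noncomputable def outDegree (D : Digraph V) (v : V) : ℕ∞ :=
  (D.outNeighbors v).encard

/-- The in-degree `d⁻(v)`, as an extended natural number. -/
noncomputable def inDegree (D : Digraph V) (v : V) : ℕ∞ :=
  (D.inNeighbors v).encard

/-- A tournament: an oriented digraph whose underlying graph is complete. -/
def IsTournament (D : Digraph V) : Prop :=
  D.IsOriented ∧ D.underlying = ⊤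

/-- `D` is (up to isomorphism) the digraph `T₅`, i.e. it is a tournament on five vertices
in which every vertex has out-degree two and in-degree two. -/
def IsT5 (D : Digraph V) : Prop :=
  Nat.card V = 5 ∧ D.IsTournament ∧ ∀ u, D.outDegree u = 2 ∧ D.inDegree u = 2

/-- `D` contains a copy of `H`: there is an injective map of the vertices that carries arcs
to arcs (the copy need not be induced). -/
def ContainsCopy (D : Digraph V) (H : Digraph W) : Prop :=
  ∃ f : W → V, Function.Injective f ∧ ∀ x y, H.Adj x y → D.Adj (f x) (f y)

/-- The antidirected path `p₄`: with `x, y, z, v, w` written as `0, 1, 2, 3, 4`, its arcs are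
`y → x`, `y → z`, `v → z`, `v → w`. -/
def p4 : Digraph (Fin 5) where
  Adj a b := (a, b) ∈ ({(1, 0), (1, 2), (3, 2), (3, 4)} : Set (Fin 5 × Fin 5))

end Digraph

/-! Suppose there is no copy of `p4`. If distinct `y`, `v` share an out-neighbour `z`, every
out-neighbour of `y` other than `z`, `v` equals every out-neighbour of `v` other than `z`, `y`. This
leaves the few alternatives of `IsP4Free.pair_cases`. In particular no vertex has two big
in-neighbours, where big means out-degree at least three and small means out-degree two.

By compactness some finite `X` is minimal non-4-colourable, so degrees inside `X` are at least four.
Conversely, charge arcs between big vertices to their heads and all other arcs to their tails. Each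
vertex is charged at most two, except that a big vertex with three small out-neighbours may be
charged three. Such a vertex is the apex of a diamond, whose apex and middle vertex both have degree
at least five. The two bounds on the degree sum then coincide, so all these inequalities are
equalities (`degrees_eq`), and a recolouring argument (`false_of_low_diamond`) excludes these
diamonds.

Hence all degrees in `X` are four, and Brooks' theorem (`CriticalOn.isClique`) makes `X` a clique on
five vertices. Counting big vertices shows that it is a regular tournament (`critical_regular`). No
arc can join `X` to another vertex (`critical_eq_univ`), so connectedness gives `T₅`. -/

/-! ### Critical sets and Brooks' theorem for four colours -/

open Classical in
/-- The neighbours of `v` that lie in the finite set `X`. -/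
noncomputable def SimpleGraph.nbrsIn {V : Type*} (G : SimpleGraph V) (X : Finset V) (v : V) :
    Finset V :=
  X.filter (G.Adj v)

namespace SimpleGraph

variable {V : Type*} {G : SimpleGraph V} {X Y : Finset V}

/-- `c` is a proper colouring of the subgraph induced on `X`. -/
def ProperOn (G : SimpleGraph V) (X : Finset V) (c : V → Fin 4) : Prop :=
  ∀ ⦃u⦄, u ∈ X → ∀ ⦃v⦄, v ∈ X → G.Adj u v → c u ≠ c v

/-- `X` is minimal among the finite sets whose induced subgraph is not 4-colourable. -/
def CriticalOn (G : SimpleGraph V) (X : Finset V) : Prop :=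
  (∀ c, ¬ G.ProperOn X c) ∧ ∀ Y, Y ⊂ X → ∃ c, G.ProperOn Y c

@[simp] lemma mem_nbrsIn {u v : V} : u ∈ G.nbrsIn X v ↔ u ∈ X ∧ G.Adj v u := by
  simp [nbrsIn]

lemma nbrsIn_mono (h : Y ⊆ X) (v : V) : G.nbrsIn Y v ⊆ G.nbrsIn X v := by
  intro u hu
  rw [mem_nbrsIn] at hu ⊢
  exact ⟨h hu.1, hu.2⟩

lemma ProperOn.mono {c : V → Fin 4} (hc : G.ProperOn X c) (h : Y ⊆ X) : G.ProperOn Y c :=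
  fun _ hu _ hv => hc (h hu) (h hv)

section

open Classical

lemma ProperOn.insert_of_color {c : V → Fin 4} (hc : G.ProperOn Y c) {v : V}
    {e : Fin 4} (he : ∀ u ∈ Y, G.Adj v u → c u ≠ e) :
    G.ProperOn (insert v Y) (Function.update c v e) := by
  intro a ha b hb hab
  rw [Finset.mem_insert] at ha hb
  have hne := hab.ne
  have hab' := hab.symm
  simp only [Function.update_apply]
  have := @hc a
  grind

lemma ProperOn.extend {c : V → Fin 4} (hc : G.ProperOn Y c) {v : V} (hv : v ∉ Y)
    (hcard : ((G.nbrsIn Y v).image c).card < 4) :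
    ∃ c', G.ProperOn (insert v Y) c' ∧ ∀ u ∈ Y, c' u = c u := by
  obtain ⟨e, he⟩ : ∃ e, e ∉ (G.nbrsIn Y v).image c := by
    by_contra hcon
    push Not at hcon
    have : (G.nbrsIn Y v).image c = Finset.univ := Finset.eq_univ_iff_forall.2 hcon
    rw [this] at hcard
    simp at hcard
  refine ⟨Function.update c v e, hc.insert_of_color ?_, ?_⟩
  · intro u hu hvu huc
    exact he (Finset.mem_image.2 ⟨u, mem_nbrsIn.2 ⟨hu, hvu⟩, huc⟩)
  · intro u hu
    rw [Function.update_of_ne]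
    rintro rfl
    exact hv hu

lemma CriticalOn.four_le (hX : G.CriticalOn X) {v : V} (hv : v ∈ X) :
    4 ≤ (G.nbrsIn X v).card := by
  by_contra hcon
  obtain ⟨c, hc⟩ := hX.2 (X.erase v) (Finset.erase_ssubset hv)
  obtain ⟨c', hc', -⟩ := hc.extend (Finset.notMem_erase v X) (by
    refine lt_of_le_of_lt (Finset.card_image_le.trans (Finset.card_le_card ?_)) (not_le.1 hcon)
    exact nbrsIn_mono (Finset.erase_subset v X) v)
  rw [Finset.insert_erase hv] at hc'
  exact hX.1 c' hc'

/-- Critical sets are connected: without such an edge, colourings of `Y` and `X \ Y` could be glued.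
-/
lemma CriticalOn.exists_edge (hX : G.CriticalOn X) (hY : Y ⊂ X) (hne : Y.Nonempty) :
    ∃ u ∈ Y, ∃ v ∈ X, v ∉ Y ∧ G.Adj u v := by
  by_contra hcon
  push Not at hcon
  obtain ⟨c, hc⟩ := hX.2 Y hY
  obtain ⟨d, hd⟩ := hX.2 (X \ Y) (Finset.sdiff_ssubset hY.1 hne)
  refine hX.1 (fun v => if v ∈ Y then c v else d v) ?_
  intro a ha b hb hab
  have h1 := hcon a
  have h2 := hcon b
  have h3 := hab.symm
  have h4 := @hc a
  have h5 := @hd a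
  simp only [Finset.mem_sdiff] at h5
  grind

/-- Two vertices of a critical set do not have nested neighbourhoods. -/
lemma CriticalOn.not_nbrsIn_subset (hX : G.CriticalOn X) {u v : V} (hu : u ∈ X) (hv : v ∈ X)
    (huv : u ≠ v) (h : ∀ x ∈ X, G.Adj u x → G.Adj v x) : False := by
  obtain ⟨c, hc⟩ := hX.2 (X.erase u) (Finset.erase_ssubset hu)
  have := hc.insert_of_color (v := u) (e := c v) (by
    intro x hx hux
    have hxX := Finset.mem_of_mem_erase hx
    exact hc hx (Finset.mem_erase.2 ⟨huv.symm, hv⟩) (h x hxX hux).symm)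
  rw [Finset.insert_erase hu] at this
  exact hX.1 _ this

/-- Colour `L` greedily in order. When a vertex is reached, its successor on the chain is a
neighbour still uncoloured, so at most three colours are blocked. The last vertex `t` only serves as
a successor and stays uncoloured. -/
lemma ProperOn.extend_chain (hdeg : ∀ v ∈ X, (G.nbrsIn X v).card ≤ 4) (t : V) (L : List V) :
    ∀ (Y : Finset V) (c : V → Fin 4), Y ⊆ X → G.ProperOn Y c →
      (L ++ [t]).IsChain G.Adj → (L ++ [t]).Nodup → (∀ x ∈ L ++ [t], x ∈ X ∧ x ∉ Y) →
      ∃ c', G.ProperOn (Y ∪ L.toFinset) c' ∧ ∀ u ∈ Y, c' u = c u := by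
  induction L with
  | nil => intro Y c _ hc _ _ _; exact ⟨c, by simpa using hc, fun _ _ => rfl⟩
  | cons x L ih =>
    intro Y c hYX hc hchain hnd hmem
    obtain ⟨b, B, hb⟩ : ∃ b B, L ++ [t] = b :: B := List.exists_cons_of_ne_nil (by simp)
    have hx := hmem x (by simp)
    have hbm := hmem b (by simp [hb])
    rw [List.cons_append] at hchain hnd
    have hxb : G.Adj x b := by
      rw [hb] at hchain
      exact (List.isChain_cons_cons.1 hchain).1
    obtain ⟨c₁, hc₁, hag⟩ := hc.extend hx.2 (by
      refine lt_of_le_of_lt Finset.card_image_le ?_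
      have : G.nbrsIn Y x ⊂ G.nbrsIn X x := by
        refine ⟨nbrsIn_mono hYX x, fun h => ?_⟩
        have := h (mem_nbrsIn.2 ⟨hbm.1, hxb⟩)
        exact hbm.2 (mem_nbrsIn.1 this).1
      exact lt_of_lt_of_le (Finset.card_lt_card this) (hdeg x hx.1))
    obtain ⟨c₂, hc₂, hag₂⟩ := ih (insert x Y) c₁ (Finset.insert_subset hx.1 hYX) hc₁
      hchain.tail (List.nodup_cons.1 hnd).2 (by
        intro y hy
        have h1 := hmem y (List.mem_cons_of_mem _ hy)
        refine ⟨h1.1, ?_⟩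
        rw [Finset.mem_insert, not_or]
        refine ⟨?_, h1.2⟩
        rintro rfl
        exact (List.nodup_cons.1 hnd).1 hy)
    refine ⟨c₂, ?_, fun u hu => ?_⟩
    · convert hc₂ using 1
      ext z
      simp only [Finset.mem_union, List.mem_toFinset, List.mem_cons, Finset.mem_insert]
      tauto
    · rw [hag₂ u (Finset.mem_insert_of_mem hu), hag u hu]

/-- The at most four neighbours of `t` show at most three colours, so `t` can be coloured too. -/
lemma CriticalOn.false_of_repeat (hX : G.CriticalOn X) {t a b : V} {c : V → Fin 4}
    (ht : t ∈ X) (hdeg : (G.nbrsIn X t).card ≤ 4) (hc : G.ProperOn (X.erase t) c)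
    (ha : a ∈ X) (hb : b ∈ X) (hab : a ≠ b) (hta : G.Adj t a) (htb : G.Adj t b)
    (heq : c a = c b) : False := by
  obtain ⟨c', hc', -⟩ := hc.extend (Finset.notMem_erase t X) (by
    refine lt_of_lt_of_le (lt_of_le_of_ne Finset.card_image_le ?_)
      ((Finset.card_le_card (nbrsIn_mono (Finset.erase_subset t X) t)).trans hdeg)
    intro h
    have hinj := Finset.card_image_iff.1 h
    refine hab (hinj ?_ ?_ heq) <;>
      simp only [Finset.mem_coe, mem_nbrsIn, Finset.mem_erase]
    · exact ⟨⟨hta.ne.symm, ha⟩, hta⟩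
    · exact ⟨⟨htb.ne.symm, hb⟩, htb⟩)
  rw [Finset.insert_erase ht] at hc'
  exact hX.1 c' hc'

lemma _root_.List.exists_split_first {α : Type*} (p : α → Prop) (l : List α) (h : ∃ x ∈ l, p x) :
    ∃ A z B, l = A ++ z :: B ∧ p z ∧ ∀ y ∈ A, ¬ p y := by
  induction l with
  | nil => simp at h
  | cons x l ih =>
    by_cases hx : p x
    · exact ⟨[], x, l, rfl, hx, by simp⟩
    · obtain ⟨A, z, B, rfl, hz, hA⟩ := ih (by
        obtain ⟨y, hy, hpy⟩ := h
        rcases List.mem_cons.1 hy with rfl | hy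
        · exact absurd hpy hx
        · exact ⟨y, hy, hpy⟩)
      refine ⟨x :: A, z, B, rfl, hz, ?_⟩
      intro y hy
      rcases List.mem_cons.1 hy with rfl | hy
      · exact hx
      · exact hA y hy

lemma _root_.List.exists_split_last {α : Type*} (p : α → Prop) (l : List α) (h : ∃ x ∈ l, p x) :
    ∃ A z B, l = A ++ z :: B ∧ p z ∧ ∀ y ∈ B, ¬ p y := by
  obtain ⟨A, z, B, hl, hz, hA⟩ := l.reverse.exists_split_first p (by simpa using h)
  refine ⟨B.reverse, z, A.reverse, ?_, hz, by simpa using hA⟩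
  rw [← List.reverse_reverse l, hl]
  simp

lemma _root_.List.IsChain.reverse_of_adj {l : List V} (h : l.IsChain G.Adj) :
    l.reverse.IsChain G.Adj := by
  rw [List.isChain_reverse]
  exact h.imp fun _ _ hab => hab.symm

lemma CriticalOn.exists_induced_path (hX : G.CriticalOn X)
    (hnc : ∃ u ∈ X, ∃ v ∈ X, u ≠ v ∧ ¬ G.Adj u v) :
    ∃ a ∈ X, ∃ w ∈ X, ∃ b ∈ X, G.Adj a w ∧ G.Adj w b ∧ a ≠ b ∧ ¬ G.Adj a b := by
  by_contra hcon
  push Not at hcon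
  obtain ⟨u, hu, v, hv, huv, hnadj⟩ := hnc
  obtain ⟨x, hx, z, hz, hzN, hxz⟩ := hX.exists_edge (Y := insert u (G.nbrsIn X u))
    ⟨by
      intro y hy
      rcases Finset.mem_insert.1 hy with rfl | hy
      · exact hu
      · exact (mem_nbrsIn.1 hy).1, fun h => by
      rcases Finset.mem_insert.1 (h hv) with h | h
      · exact huv h.symm
      · exact hnadj (mem_nbrsIn.1 h).2⟩ (Finset.insert_nonempty _ _)
  rw [Finset.mem_insert, not_or, mem_nbrsIn, not_and] at hzN
  rcases Finset.mem_insert.1 hx with rfl | hx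
  · exact hzN.2 hz hxz
  · rw [mem_nbrsIn] at hx
    exact hzN.2 hz (hcon u hu x hx.1 z hz hx.2 hxz (Ne.symm hzN.1))

/-- If the long end `h` of a path sends all its edges to the path, but the path does not cover
the critical set `X`, then a colouring can be completed around a cycle through `h`. -/
lemma CriticalOn.false_of_path_not_covering (hX : G.CriticalOn X)
    (hdeg : ∀ v ∈ X, (G.nbrsIn X v).card ≤ 4) {h : V} {T : List V}
    (hchain : (h :: T).IsChain G.Adj) (hnd : (h :: T).Nodup) (hmem : ∀ x ∈ h :: T, x ∈ X)
    (hT : T ≠ []) (hclosed : ∀ x ∈ X, G.Adj h x → x ∈ T) {o : V} (ho : o ∈ X)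
    (hoT : o ∉ h :: T) : False := by
  -- Cutting the path after the last neighbour `z` of `h` leaves a segment `C` that the edge `h z`
  -- closes to a cycle containing all neighbours of `h` in `X`.
  obtain ⟨A, z, B, rfl, hz, hB⟩ := T.exists_split_last (G.Adj h) (by
    obtain ⟨b, T', rfl⟩ := List.exists_cons_of_ne_nil hT
    exact ⟨b, by simp, (List.isChain_cons_cons.1 hchain).1⟩)
  have hsplit : h :: (A ++ z :: B) = (h :: A ++ [z]) ++ B := by simp
  obtain ⟨C, hC⟩ : ∃ C, C = h :: A ++ [z] := ⟨_, rfl⟩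
  rw [hsplit, ← hC] at hchain hnd hmem hoT
  have hCchain : C.IsChain G.Adj := (List.isChain_append.1 hchain).1
  have hCnd : C.Nodup := (List.nodup_append.1 hnd).1
  have hCX : ∀ x ∈ C, x ∈ X := fun x hx => hmem x (List.mem_append_left _ hx)
  have hhC : ∀ x ∈ X, G.Adj h x → x ∈ C := by
    intro x hx hhx
    have h1 := hclosed x hx hhx
    have h2 := hB x
    rw [hC]
    simp only [List.mem_append, List.mem_cons] at h1 ⊢
    tauto
  obtain ⟨u₀, hu₀, v₀, hv₀, hvC, huv⟩ := hX.exists_edge (Y := C.toFinset)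
    ⟨fun x hx => hCX x (List.mem_toFinset.1 hx),
      fun hsub => hoT (List.mem_append_left _ (List.mem_toFinset.1 (hsub ho)))⟩
    ⟨h, by simp [hC]⟩
  -- `k` is the first vertex of the cycle with a neighbour `x` off it. It is not `h`, and its
  -- predecessor `u` has no neighbour off the cycle, so `u` may copy the colour of `x`.
  obtain ⟨A', k, R, hCk, ⟨x, hx, hxC, hkx⟩, hA'⟩ :=
    C.exists_split_first (fun u => ∃ x ∈ X, x ∉ C ∧ G.Adj u x)
      ⟨u₀, List.mem_toFinset.1 hu₀, v₀, hv₀, by simpa using hvC, huv⟩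
  have hA'ne : A' ≠ [] := by
    rintro rfl
    rw [hC] at hCk
    simp only [List.cons_append, List.nil_append, List.cons.injEq] at hCk
    obtain ⟨rfl, -⟩ := hCk
    exact hxC (hhC x hx hkx)
  obtain ⟨A'', u, rfl⟩ : ∃ A'' u, A' = A'' ++ [u] :=
    ⟨_, _, (List.dropLast_append_getLast hA'ne).symm⟩
  have hCk' : C = A'' ++ u :: k :: R := by simp [hCk]
  obtain ⟨c, hc⟩ := hX.2 (X \ C.toFinset) (Finset.sdiff_ssubset
    (fun x hx => hCX x (List.mem_toFinset.1 hx)) ⟨h, by simp [hC]⟩)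
  have huC : u ∈ C := by simp [hCk']
  have hc₁ := hc.insert_of_color (v := u) (e := c x) (by
    intro y hy huy
    exfalso
    simp only [Finset.mem_sdiff, List.mem_toFinset] at hy
    exact hA' u (by simp) ⟨y, hy.1, hy.2, huy⟩)
  have hchk := hCchain
  rw [hCk', List.isChain_append, List.isChain_cons_cons] at hchk
  have hndk := hCnd
  rw [hCk'] at hndk
  have hux : x ≠ u := fun he => hxC (he ▸ huC)
  -- Go round the cycle from `u` away from `k`: back to `h`, across to `z`, and back to `k`, which
  -- then sees the same colour on `u` and `x`.
  obtain ⟨c₂, hc₂, hag⟩ := ProperOn.extend_chain hdeg k (A''.reverse ++ R.reverse) _ _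
    (by
      intro y hy
      rcases Finset.mem_insert.1 hy with rfl | hy
      · exact hCX _ huC
      · exact (Finset.mem_sdiff.1 hy).1) hc₁
    (by
      rw [List.append_assoc, ← List.reverse_cons, List.isChain_append]
      refine ⟨hchk.1.reverse_of_adj, hchk.2.1.2.reverse_of_adj, ?_⟩
      intro p hp q hq
      rw [List.getLast?_reverse] at hp
      rw [List.head?_reverse] at hq
      have hph : p = h := by
        have : p ∈ C.head? := by
          rw [hCk']
          cases A'' with
          | nil => simp at hp
          | cons a l => simpa using hp
        rw [hC] at this
        simpa using this.symm
      have hqz : q = z := by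
        have : q ∈ C.getLast? := by
          rw [hCk', List.getLast?_append, List.getLast?_cons_cons]
          simp only [Option.mem_def] at hq ⊢
          rw [hq]; rfl
        rw [hC, List.getLast?_concat] at this
        simpa using this.symm
      rw [hph, hqz]
      exact hz)
    (by
      have : (A''.reverse ++ R.reverse ++ [k]).Perm (A'' ++ k :: R) := by
        rw [List.append_assoc, ← List.reverse_cons]
        exact (List.reverse_perm _).append (List.reverse_perm _)
      rw [this.nodup_iff]
      refine hndk.sublist ?_
      exact (List.Sublist.refl _).append (List.sublist_cons_self _ _))
    (by
      intro y hy
      have hyC : y ∈ C := by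
        rw [hCk']
        simp only [List.mem_append, List.mem_reverse, List.mem_cons] at hy ⊢
        tauto
      refine ⟨hCX y hyC, ?_⟩
      simp only [Finset.mem_insert, Finset.mem_sdiff, List.mem_toFinset, hyC, not_true,
        and_false, or_false]
      rintro rfl
      simp only [List.mem_append, List.mem_reverse, List.mem_cons] at hy
      grind)
  have hkC : k ∈ C := by simp [hCk']
  refine hX.false_of_repeat (t := k) (a := u) (b := x) (hCX k hkC) (hdeg k (hCX k hkC))
    (hc₂.mono ?_) (hCX u huC) hx hux.symm hchk.2.1.1.symm hkx ?_
  · intro y hy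
    rw [Finset.mem_erase] at hy
    by_cases hyC : y ∈ C
    · rw [hCk'] at hyC
      simp only [List.mem_append, List.mem_cons] at hyC
      simp only [Finset.mem_union, Finset.mem_insert, List.mem_toFinset, List.mem_append,
        List.mem_reverse]
      tauto
    · simp [hy.2, hyC]
  · rw [hag u (by simp), hag x (by simp [hx, hxC]), Function.update_self,
      Function.update_of_ne hux]

/-- Give `a` and `b` the same colour. As `w` has degree at least four, it has a neighbour `x` in
`R`. Colour greedily towards `x` from the side of `b`, then from the other end through `x`, whose
uncoloured neighbour is `w`. Finally `w` sees `a` and `b` in one colour. -/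
lemma CriticalOn.false_of_path_covering (hX : G.CriticalOn X)
    (hdeg : ∀ v ∈ X, (G.nbrsIn X v).card ≤ 4) {a w b : V} {R : List V}
    (hchain : (R ++ [b, w, a]).IsChain G.Adj) (hnd : (R ++ [b, w, a]).Nodup)
    (hmem : ∀ x, x ∈ R ++ [b, w, a] ↔ x ∈ X) (hab : ¬ G.Adj a b) : False := by
  have hwX : w ∈ X := (hmem w).1 (by simp)
  have haX : a ∈ X := (hmem a).1 (by simp)
  have hbX : b ∈ X := (hmem b).1 (by simp)
  obtain ⟨x, hx, hxab⟩ := Finset.exists_mem_notMem_of_card_lt_card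
    (lt_of_le_of_lt (Finset.card_le_two (a := a) (b := b))
      (lt_of_lt_of_le (by norm_num) (hX.four_le hwX)))
  rw [mem_nbrsIn] at hx
  obtain ⟨hxX, hwx⟩ := hx
  have hxR : x ∈ R := by
    have h1 := (hmem x).2 hxX
    have h2 := hwx.ne
    simp only [List.mem_append, List.mem_cons, List.not_mem_nil, or_false] at h1
    simp only [Finset.mem_insert, Finset.mem_singleton] at hxab
    grind
  obtain ⟨R₁, R₂, rfl⟩ := List.append_of_mem hxR
  have hch := hchain
  rw [List.append_assoc, List.cons_append, List.isChain_append] at hch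
  have hch2 : (x :: R₂).IsChain G.Adj := by
    have := hch.2.1
    rw [← List.cons_append] at this
    exact (List.isChain_append.1 this).1
  have hch3 : (b :: w :: [a]).IsChain G.Adj := (List.isChain_append.1 hchain).2.1
  have hbw : G.Adj b w := (List.isChain_cons_cons.1 hch3).1
  have hwa : G.Adj w a := (List.isChain_cons_cons.1 (List.isChain_cons_cons.1 hch3).2).1
  have hbnea : b ≠ a := by
    rintro rfl
    exact absurd (List.nodup_append.1 hnd).2.1 (by simp)
  have hc₀ : G.ProperOn {a, b} (fun _ => 0) := by
    intro p hp q hq hpq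
    have h1 := hpq.ne
    have h2 := hpq.symm
    simp only [Finset.mem_insert, Finset.mem_singleton] at hp hq
    grind
  have hnd1 : (R₁ ++ x :: R₂).Nodup := (List.nodup_append.1 hnd).1
  have hdisj := (List.nodup_append.1 hnd).2.2
  have hR : ∀ y ∈ R₁ ++ x :: R₂, y ∈ X ∧ y ≠ a ∧ y ≠ b ∧ y ≠ w := fun y hy =>
    ⟨(hmem y).1 (List.mem_append_left _ hy), hdisj y hy a (by simp), hdisj y hy b (by simp),
      hdisj y hy w (by simp)⟩
  obtain ⟨c₁, hc₁, hag₁⟩ := ProperOn.extend_chain hdeg x R₂.reverse _ _ (by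
      intro y hy
      simp only [Finset.mem_insert, Finset.mem_singleton] at hy
      rcases hy with rfl | rfl <;> assumption) hc₀
    (by rw [← List.reverse_cons]; exact hch2.reverse_of_adj)
    (by rw [← List.reverse_cons, List.nodup_reverse]; exact (List.nodup_append.1 hnd1).2.1)
    (by
      intro y hy
      have := hR y (by
        simp only [List.mem_append, List.mem_reverse, List.mem_cons, List.not_mem_nil,
          or_false] at hy ⊢
        tauto)
      simp only [Finset.mem_insert, Finset.mem_singleton]
      tauto)
  have hnd2 : (R₁ ++ [x]).Nodup ∧ ∀ y ∈ R₁ ++ [x], y ∉ R₂ := by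
    rw [← List.singleton_append, ← List.append_assoc] at hnd1
    exact ⟨(List.nodup_append.1 hnd1).1, fun y hy hy' => (List.nodup_append.1 hnd1).2.2 y hy y hy' rfl⟩
  obtain ⟨c₂, hc₂, hag₂⟩ := ProperOn.extend_chain hdeg w (R₁ ++ [x]) _ _ (by
      intro y hy
      simp only [Finset.mem_union, Finset.mem_insert, Finset.mem_singleton, List.mem_toFinset,
        List.mem_reverse] at hy
      rcases hy with (rfl | rfl) | hy
      · assumption
      · assumption
      · exact (hR y (by simp [hy])).1) hc₁
    (by
      rw [List.isChain_append]
      refine ⟨?_, by simp, ?_⟩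
      · rw [List.isChain_append]
        refine ⟨hch.1, by simp, ?_⟩
        simpa using hch.2.2
      · simpa using hwx.symm)
    (by
      rw [List.nodup_append]
      refine ⟨hnd2.1, by simp, ?_⟩
      intro y hy y' hy'
      rw [List.mem_singleton.1 hy']
      refine (hR y ?_).2.2.2
      simp only [List.mem_append, List.mem_cons, List.not_mem_nil, or_false] at hy ⊢
      tauto)
    (by
      intro y hy
      rw [List.mem_append, List.mem_singleton] at hy
      rcases hy with hy | rfl
      · have h1 := hR y (by
          simp only [List.mem_append, List.mem_cons, List.not_mem_nil, or_false] at hy ⊢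
          tauto)
        have h2 := hnd2.2 y hy
        simp only [Finset.mem_union, Finset.mem_insert, Finset.mem_singleton,
          List.mem_toFinset, List.mem_reverse]
        tauto
      · refine ⟨hwX, ?_⟩
        have h1 := hR y
        have h2 := hbw.ne
        have h3 := hwa.ne
        simp only [Finset.mem_union, Finset.mem_insert, Finset.mem_singleton,
          List.mem_toFinset, List.mem_reverse]
        simp only [List.mem_append, List.mem_cons] at h1
        tauto)
  refine hX.false_of_repeat hwX (hdeg w hwX) (hc₂.mono ?_) haX hbX hbnea.symm hwa hbw.symm ?_
  · intro y hy
    rw [Finset.mem_erase, ← hmem] at hy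
    simp only [List.mem_append, List.mem_cons, List.not_mem_nil, or_false] at hy
    simp only [Finset.mem_union, Finset.mem_insert, Finset.mem_singleton, List.mem_toFinset,
      List.mem_reverse, List.mem_append, List.mem_cons, List.not_mem_nil, or_false]
    tauto
  · rw [hag₂ a (by simp), hag₂ b (by simp), hag₁ a (by simp), hag₁ b (by simp)]

/-- **Brooks' theorem** for critical sets: a critical set all of whose degrees are at most four
is a clique. -/
theorem CriticalOn.isClique (hX : G.CriticalOn X)
    (hdeg : ∀ v ∈ X, (G.nbrsIn X v).card ≤ 4) {u v : V} (hu : u ∈ X) (hv : v ∈ X)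
    (huv : u ≠ v) : G.Adj u v := by
  by_contra hnadj
  obtain ⟨a, ha, w, hw, b, hb, haw, hwb, hab, hnab⟩ :=
    hX.exists_induced_path ⟨u, hu, v, hv, huv, hnadj⟩
  let P : List V → Prop := fun R => (R ++ [b, w, a]).IsChain G.Adj ∧ (R ++ [b, w, a]).Nodup ∧
    ∀ x ∈ R ++ [b, w, a], x ∈ X
  have hP0 : P [] := by
    refine ⟨?_, ?_, ?_⟩
    · simp [hwb.symm, haw.symm]
    · simp [hwb.ne.symm, haw.ne.symm, hab.symm]
    · simp [ha, hb, hw]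
  have hbound : ∀ R, P R → R.length ≤ X.card := by
    intro R hR
    have h1 := List.toFinset_card_of_nodup hR.2.1
    have h2 : (R ++ [b, w, a]).toFinset.card ≤ X.card :=
      Finset.card_le_card fun x hx => hR.2.2 x (List.mem_toFinset.1 hx)
    rw [h1] at h2
    simp only [List.length_append] at h2
    omega
  -- The tail `b, w, a` is kept fixed and the path is as long as possible at its head, so all
  -- neighbours of the head in `X` lie on the path.
  obtain ⟨R, hR, hmax⟩ : ∃ R, P R ∧ ∀ R', P R' → R'.length ≤ R.length := by
    obtain ⟨R, hR, hlen⟩ := Nat.findGreatest_spec (P := fun n => ∃ R, P R ∧ R.length = n)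
      (Nat.zero_le X.card) ⟨[], hP0, rfl⟩
    refine ⟨R, hR, fun R' hR' => ?_⟩
    rw [hlen]
    exact Nat.le_findGreatest (hbound R' hR') ⟨R', hR', rfl⟩
  obtain ⟨hch, hnd, hmem⟩ := hR
  by_cases hcov : ∀ x ∈ X, x ∈ R ++ [b, w, a]
  · exact hX.false_of_path_covering hdeg hch hnd (fun x => ⟨hmem x, hcov x⟩) hnab
  · push Not at hcov
    obtain ⟨o, ho, hoL⟩ := hcov
    obtain ⟨h, T, hT⟩ : ∃ h T, R ++ [b, w, a] = h :: T :=
      List.exists_cons_of_ne_nil (by simp)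
    have hTne : T ≠ [] := by
      rintro rfl
      have := congrArg List.length hT
      simp at this
    refine hX.false_of_path_not_covering hdeg (hT ▸ hch) (hT ▸ hnd) (hT ▸ hmem) hTne ?_ ho
      (hT ▸ hoL)
    intro x hx hhx
    by_contra hxT
    have hxL : x ∉ h :: T := by
      rw [List.mem_cons, not_or]
      exact ⟨hhx.ne.symm, hxT⟩
    have := hmax (x :: R) (by
      refine ⟨?_, ?_, ?_⟩
      · rw [List.cons_append, hT, List.isChain_cons_cons]
        exact ⟨hhx.symm, hT ▸ hch⟩
      · rw [List.cons_append, hT, List.nodup_cons]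
        exact ⟨hxL, hT ▸ hnd⟩
      · intro y hy
        rw [List.cons_append] at hy
        rcases List.mem_cons.1 hy with rfl | hy
        · exact hx
        · exact hmem y hy)
    simp at this

end

end SimpleGraph

/-! ### Colouring four vertices with two of the four colours -/

section FourColours

/-- The six two-element subsets of the set of four colours. -/
abbrev colourPairs : Finset (Fin 4 × Fin 4) :=
  Finset.univ.filter fun x => x.1 < x.2

/-- The pairs of colours contained in `{f, g}`. -/
abbrev blockedPairs (f g : Fin 4) : Finset (Fin 4 × Fin 4) :=
  colourPairs.filter fun x => (x.1 = f ∨ x.1 = g) ∧ (x.2 = f ∨ x.2 = g)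

/-- The pairs of colours with which an edge cannot be coloured, if `f` is forbidden at one end
and `g` at the other one. -/
abbrev edgeBlockedPairs (f g : Fin 4) : Finset (Fin 4 × Fin 4) :=
  colourPairs.filter fun x => ¬ ((x.1 ≠ f ∧ x.2 ≠ g) ∨ (x.2 ≠ f ∧ x.1 ≠ g))

lemma card_blockedPairs (f g : Fin 4) : (blockedPairs f g).card ≤ 1 := by
  revert f g; decide

lemma card_edgeBlockedPairs (f g : Fin 4) : (edgeBlockedPairs f g).card ≤ 3 := by
  revert f g; decide

lemma exists_colourPair_of_card {B : Finset (Fin 4 × Fin 4)} (hB : B.card < 6) :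
    ∃ i j : Fin 4, i ≠ j ∧ (i, j) ∈ colourPairs ∧ (i, j) ∉ B := by
  obtain ⟨⟨i, j⟩, hx, hxB⟩ := Finset.exists_mem_notMem_of_card_lt_card
    (lt_of_lt_of_eq hB (by decide : 6 = colourPairs.card))
  have hij : i < j := by simpa using hx
  exact ⟨i, j, hij.ne, hx, hxB⟩

lemma exists_free_of_notMem {i j f g : Fin 4} (h : (i, j) ∈ colourPairs)
    (hB : (i, j) ∉ blockedPairs f g) : ∃ a, (a = i ∨ a = j) ∧ a ≠ f ∧ a ≠ g := by
  rw [Finset.mem_filter, not_and] at hB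
  have := hB h
  by_cases hi : i = f ∨ i = g
  · exact ⟨j, Or.inr rfl, by tauto⟩
  · exact ⟨i, Or.inl rfl, by tauto⟩

lemma exists_free_edge_of_notMem {i j f g : Fin 4} (hij : i ≠ j) (h : (i, j) ∈ colourPairs)
    (hB : (i, j) ∉ edgeBlockedPairs f g) :
    ∃ a b, (a = i ∨ a = j) ∧ (b = i ∨ b = j) ∧ a ≠ b ∧ a ≠ f ∧ b ≠ g := by
  rw [Finset.mem_filter, not_and, not_not] at hB
  rcases hB h with h | h
  · exact ⟨i, j, Or.inl rfl, Or.inr rfl, hij, h⟩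
  · exact ⟨j, i, Or.inr rfl, Or.inl rfl, hij.symm, h⟩

variable (f₁ g₁ f₂ g₂ f₃ g₃ f₄ g₄ : Fin 4)

lemma exists_pair_free : ∃ i j : Fin 4, i ≠ j ∧ (∃ a, (a = i ∨ a = j) ∧ a ≠ f₁ ∧ a ≠ g₁) ∧
    (∃ a, (a = i ∨ a = j) ∧ a ≠ f₂ ∧ a ≠ g₂) ∧ (∃ a, (a = i ∨ a = j) ∧ a ≠ f₃ ∧ a ≠ g₃) ∧
    ∃ a, (a = i ∨ a = j) ∧ a ≠ f₄ ∧ a ≠ g₄ := by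
  obtain ⟨i, j, hij, hmem, hB⟩ := exists_colourPair_of_card (lt_of_le_of_lt
    ((Finset.card_union_le _ _).trans (add_le_add ((Finset.card_union_le _ _).trans
      (add_le_add (card_blockedPairs f₁ g₁) (card_blockedPairs f₂ g₂)))
      ((Finset.card_union_le _ _).trans
      (add_le_add (card_blockedPairs f₃ g₃) (card_blockedPairs f₄ g₄))))) (by norm_num))
  rw [Finset.mem_union, Finset.mem_union, Finset.mem_union, not_or, not_or, not_or] at hB
  exact ⟨i, j, hij, exists_free_of_notMem hmem hB.1.1, exists_free_of_notMem hmem hB.1.2,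
    exists_free_of_notMem hmem hB.2.1, exists_free_of_notMem hmem hB.2.2⟩

/-- An edge blocks at most three of the six colour pairs and each single vertex at most one, so at
most five are blocked. -/
lemma exists_pair_edge : ∃ i j : Fin 4, i ≠ j ∧
    (∃ a b, (a = i ∨ a = j) ∧ (b = i ∨ b = j) ∧ a ≠ b ∧ a ≠ f₁ ∧ b ≠ g₁) ∧
    (∃ a, (a = i ∨ a = j) ∧ a ≠ f₃ ∧ a ≠ g₃) ∧ ∃ a, (a = i ∨ a = j) ∧ a ≠ f₄ ∧ a ≠ g₄ := by
  obtain ⟨i, j, hij, hmem, hB⟩ := exists_colourPair_of_card (lt_of_le_of_lt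
    ((Finset.card_union_le _ _).trans (add_le_add (card_edgeBlockedPairs f₁ g₁)
      ((Finset.card_union_le _ _).trans
      (add_le_add (card_blockedPairs f₃ g₃) (card_blockedPairs f₄ g₄))))) (by norm_num))
  rw [Finset.mem_union, Finset.mem_union, not_or, not_or] at hB
  exact ⟨i, j, hij, exists_free_edge_of_notMem hij hmem hB.1,
    exists_free_of_notMem hmem hB.2.1, exists_free_of_notMem hmem hB.2.2⟩

lemma exists_pair_matching : ∃ i j : Fin 4, i ≠ j ∧
    (∃ a b, (a = i ∨ a = j) ∧ (b = i ∨ b = j) ∧ a ≠ b ∧ a ≠ f₁ ∧ b ≠ g₁) ∧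
    (∃ a b, (a = i ∨ a = j) ∧ (b = i ∨ b = j) ∧ a ≠ b ∧ a ≠ f₂ ∧ b ≠ g₂) := by
  -- Counting is not enough here: two edges could block three pairs each, all six together. Hence
  -- the exhaustive check.
  have key : ∀ f₁ g₁ f₂ g₂ : Fin 4, ∃ i j : Fin 4, i ≠ j ∧
      ((i ≠ f₁ ∧ j ≠ g₁) ∨ (j ≠ f₁ ∧ i ≠ g₁)) ∧ ((i ≠ f₂ ∧ j ≠ g₂) ∨ (j ≠ f₂ ∧ i ≠ g₂)) := by
    decide
  obtain ⟨i, j, hij, h1, h2⟩ := key f₁ g₁ f₂ g₂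
  refine ⟨i, j, hij, ?_, ?_⟩
  · rcases h1 with h | h
    · exact ⟨i, j, by tauto⟩
    · exact ⟨j, i, by tauto⟩
  · rcases h2 with h | h
    · exact ⟨i, j, by tauto⟩
    · exact ⟨j, i, by tauto⟩

/-- For a star with two leaves: both leaves get `i`, and the centre, which has no forbidden colour,
gets `j`. -/
lemma exists_pair_star : ∃ i j : Fin 4, i ≠ j ∧ i ≠ f₁ ∧ i ≠ f₂ ∧
    ∃ a, (a = i ∨ a = j) ∧ a ≠ f₃ ∧ a ≠ g₃ := by
  have key : ∀ f₁ f₂ f₃ g₃ : Fin 4, ∃ i j : Fin 4, i ≠ j ∧ i ≠ f₁ ∧ i ≠ f₂ ∧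
      ((i ≠ f₃ ∧ i ≠ g₃) ∨ (j ≠ f₃ ∧ j ≠ g₃)) := by
    decide
  obtain ⟨i, j, hij, h1, h2, h3⟩ := key f₁ f₂ f₃ g₃
  refine ⟨i, j, hij, h1, h2, ?_⟩
  rcases h3 with h | h
  · exact ⟨i, by tauto⟩
  · exact ⟨j, by tauto⟩

lemma Finset.exists_subset_pair {F : Finset (Fin 4)} (h : F.card ≤ 2) :
    ∃ f g, ∀ x, x ≠ f → x ≠ g → x ∉ F := by
  revert F; decide

lemma Finset.exists_subset_singleton {F : Finset (Fin 4)} (h : F.card ≤ 1) :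
    ∃ f, ∀ x, x ≠ f → x ∉ F := by
  revert F; decide

/-- Given lists of colours on the vertices of two independent pairs `{p, q}`, `{s, t}`, with no
vertex of the second pair joined to both vertices of the first one, one can colour the four
vertices with two colours. -/
lemma exists_two_colouring {P Q S T : Finset (Fin 4)} {ps pt qs qt : Prop}
    (hs : ¬ (ps ∧ qs)) (ht : ¬ (pt ∧ qt)) (hP : P.card ≤ 2) (hQ : Q.card ≤ 2) (hS : S.card ≤ 2)
    (hT : T.card ≤ 2) (hps : ps → P.card ≤ 1 ∧ S.card ≤ 1) (hpt : pt → P.card ≤ 1 ∧ T.card ≤ 1)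
    (hqs : qs → Q.card ≤ 1 ∧ S.card ≤ 1) (hqt : qt → Q.card ≤ 1 ∧ T.card ≤ 1)
    (hpst : ps → pt → P = ∅) (hqst : qs → qt → Q = ∅) :
    ∃ i j a b c d : Fin 4, i ≠ j ∧ (a = i ∨ a = j) ∧ (b = i ∨ b = j) ∧ (c = i ∨ c = j) ∧
      (d = i ∨ d = j) ∧ a ∉ P ∧ b ∉ Q ∧ c ∉ S ∧ d ∉ T ∧ (ps → a ≠ c) ∧ (pt → a ≠ d) ∧
      (qs → b ≠ c) ∧ (qt → b ≠ d) := by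
  obtain ⟨p₁, p₂, hp⟩ := Finset.exists_subset_pair hP
  obtain ⟨q₁, q₂, hq⟩ := Finset.exists_subset_pair hQ
  obtain ⟨s₁, s₂, hs'⟩ := Finset.exists_subset_pair hS
  obtain ⟨t₁, t₂, ht'⟩ := Finset.exists_subset_pair hT
  -- At most one of the four possible edges ends at `s` and at most one at `t`. They form a star
  -- centred at `p` or `q`, a matching, a single edge, or nothing.
  by_cases e₁ : ps
  · obtain ⟨p₀, hp₀⟩ := Finset.exists_subset_singleton (hps e₁).1
    obtain ⟨s₀, hs₀⟩ := Finset.exists_subset_singleton (hps e₁).2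
    have e₃ : ¬ qs := fun h => hs ⟨e₁, h⟩
    by_cases e₂ : pt
    · have e₄ : ¬ qt := fun h => ht ⟨e₂, h⟩
      obtain ⟨t₀, ht₀⟩ := Finset.exists_subset_singleton (hpt e₂).2
      obtain ⟨i, j, hij, h1, h2, b, hb, hb1, hb2⟩ := exists_pair_star s₀ t₀ q₁ q₂
      refine ⟨i, j, j, b, i, i, hij, Or.inr rfl, hb, Or.inl rfl, Or.inl rfl, ?_, hq b hb1 hb2,
        hs₀ i h1, ht₀ i h2, fun _ => hij.symm, fun _ => hij.symm, fun h => absurd h e₃,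
        fun h => absurd h e₄⟩
      simp [hpst e₁ e₂]
    · by_cases e₄ : qt
      · obtain ⟨q₀, hq₀⟩ := Finset.exists_subset_singleton (hqt e₄).1
        obtain ⟨t₀, ht₀⟩ := Finset.exists_subset_singleton (hqt e₄).2
        obtain ⟨i, j, hij, ⟨a, c, ha, hc, hac, ha', hc'⟩, ⟨b, d, hb, hd, hbd, hb', hd'⟩⟩ :=
          exists_pair_matching p₀ s₀ q₀ t₀
        exact ⟨i, j, a, b, c, d, hij, ha, hb, hc, hd, hp₀ a ha', hq₀ b hb', hs₀ c hc',
          ht₀ d hd', fun _ => hac, fun h => absurd h e₂, fun h => absurd h e₃, fun _ => hbd⟩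
      · obtain ⟨i, j, hij, ⟨a, c, ha, hc, hac, ha', hc'⟩, ⟨b, hb, hb1, hb2⟩, d, hd, hd1, hd2⟩ :=
          exists_pair_edge p₀ s₀ q₁ q₂ t₁ t₂
        exact ⟨i, j, a, b, c, d, hij, ha, hb, hc, hd, hp₀ a ha', hq b hb1 hb2, hs₀ c hc',
          ht' d hd1 hd2, fun _ => hac, fun h => absurd h e₂, fun h => absurd h e₃,
          fun h => absurd h e₄⟩
  by_cases e₂ : pt
  · obtain ⟨p₀, hp₀⟩ := Finset.exists_subset_singleton (hpt e₂).1
    obtain ⟨t₀, ht₀⟩ := Finset.exists_subset_singleton (hpt e₂).2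
    have e₄ : ¬ qt := fun h => ht ⟨e₂, h⟩
    by_cases e₃ : qs
    · obtain ⟨q₀, hq₀⟩ := Finset.exists_subset_singleton (hqs e₃).1
      obtain ⟨s₀, hs₀⟩ := Finset.exists_subset_singleton (hqs e₃).2
      obtain ⟨i, j, hij, ⟨a, d, ha, hd, had, ha', hd'⟩, ⟨b, c, hb, hc, hbc, hb', hc'⟩⟩ :=
        exists_pair_matching p₀ t₀ q₀ s₀
      exact ⟨i, j, a, b, c, d, hij, ha, hb, hc, hd, hp₀ a ha', hq₀ b hb', hs₀ c hc',
        ht₀ d hd', fun h => absurd h e₁, fun _ => had, fun _ => hbc, fun h => absurd h e₄⟩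
    · obtain ⟨i, j, hij, ⟨a, d, ha, hd, had, ha', hd'⟩, ⟨b, hb, hb1, hb2⟩, c, hc, hc1, hc2⟩ :=
        exists_pair_edge p₀ t₀ q₁ q₂ s₁ s₂
      exact ⟨i, j, a, b, c, d, hij, ha, hb, hc, hd, hp₀ a ha', hq b hb1 hb2, hs' c hc1 hc2,
        ht₀ d hd', fun h => absurd h e₁, fun _ => had, fun h => absurd h e₃,
        fun h => absurd h e₄⟩
  by_cases e₃ : qs
  · obtain ⟨q₀, hq₀⟩ := Finset.exists_subset_singleton (hqs e₃).1
    obtain ⟨s₀, hs₀⟩ := Finset.exists_subset_singleton (hqs e₃).2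
    by_cases e₄ : qt
    · obtain ⟨t₀, ht₀⟩ := Finset.exists_subset_singleton (hqt e₄).2
      obtain ⟨i, j, hij, h1, h2, a, ha, ha1, ha2⟩ := exists_pair_star s₀ t₀ p₁ p₂
      refine ⟨i, j, a, j, i, i, hij, ha, Or.inr rfl, Or.inl rfl, Or.inl rfl, hp a ha1 ha2, ?_,
        hs₀ i h1, ht₀ i h2, fun h => absurd h e₁, fun h => absurd h e₂, fun _ => hij.symm,
        fun _ => hij.symm⟩
      simp [hqst e₃ e₄]
    · obtain ⟨i, j, hij, ⟨b, c, hb, hc, hbc, hb', hc'⟩, ⟨a, ha, ha1, ha2⟩, d, hd, hd1, hd2⟩ :=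
        exists_pair_edge q₀ s₀ p₁ p₂ t₁ t₂
      exact ⟨i, j, a, b, c, d, hij, ha, hb, hc, hd, hp a ha1 ha2, hq₀ b hb', hs₀ c hc',
        ht' d hd1 hd2, fun h => absurd h e₁, fun h => absurd h e₂, fun _ => hbc,
        fun h => absurd h e₄⟩
  by_cases e₄ : qt
  · obtain ⟨q₀, hq₀⟩ := Finset.exists_subset_singleton (hqt e₄).1
    obtain ⟨t₀, ht₀⟩ := Finset.exists_subset_singleton (hqt e₄).2
    obtain ⟨i, j, hij, ⟨b, d, hb, hd, hbd, hb', hd'⟩, ⟨a, ha, ha1, ha2⟩, c, hc, hc1, hc2⟩ :=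
      exists_pair_edge q₀ t₀ p₁ p₂ s₁ s₂
    exact ⟨i, j, a, b, c, d, hij, ha, hb, hc, hd, hp a ha1 ha2, hq₀ b hb', hs' c hc1 hc2,
      ht₀ d hd', fun h => absurd h e₁, fun h => absurd h e₂, fun h => absurd h e₃, fun _ => hbd⟩
  obtain ⟨i, j, hij, ⟨a, ha, ha1, ha2⟩, ⟨b, hb, hb1, hb2⟩, ⟨c, hc, hc1, hc2⟩, d, hd, hd1, hd2⟩ :=
    exists_pair_free p₁ p₂ q₁ q₂ s₁ s₂ t₁ t₂
  exact ⟨i, j, a, b, c, d, hij, ha, hb, hc, hd, hp a ha1 ha2, hq b hb1 hb2, hs' c hc1 hc2,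
    ht' d hd1 hd2, fun h => absurd h e₁, fun h => absurd h e₂, fun h => absurd h e₃,
    fun h => absurd h e₄⟩

end FourColours

/-! ### Recolouring around a vertex of degree four; compactness -/

namespace SimpleGraph

variable {V : Type*} {G : SimpleGraph V} {X Y : Finset V}

section

open Classical

lemma four_colours {a b c d : Fin 4} (h : ∀ e, e = a ∨ e = b ∨ e = c ∨ e = d) :
    a ≠ b ∧ a ≠ c ∧ a ≠ d ∧ b ≠ c ∧ b ≠ d ∧ c ≠ d := by
  revert a b c d; decide

/-- If a vertex `m` has only four neighbours in a critical set, then in each colouring of the rest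
they receive all four colours. -/
lemma CriticalOn.colours_of_nbrs (hX : G.CriticalOn X) {m y w p q : V} (hm : m ∈ X)
    (hmN : ∀ x ∈ X, G.Adj m x → x = y ∨ x = w ∨ x = p ∨ x = q) {c : V → Fin 4}
    (hc : G.ProperOn (X.erase m) c) (e : Fin 4) : e = c y ∨ e = c w ∨ e = c p ∨ e = c q := by
  by_contra hcon
  push Not at hcon
  have := hc.insert_of_color (v := m) (e := e) (by
    intro x hx hmx
    rcases hmN x (Finset.mem_of_mem_erase hx) hmx with rfl | rfl | rfl | rfl
    · exact hcon.1.symm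
    · exact hcon.2.1.symm
    · exact hcon.2.2.1.symm
    · exact hcon.2.2.2.symm)
  rw [Finset.insert_erase hm] at this
  exact hX.1 _ this

lemma false_of_five_nbrs {p y m x x₁ x₂ : V} (hdp : (G.nbrsIn X p).card ≤ 4)
    (hN : ∀ z ∈ ({y, m, x, x₁, x₂} : Finset V), z ∈ X ∧ G.Adj p z)
    (hnd : [y, m, x, x₁, x₂].Nodup) : False := by
  have hcard : ({y, m, x, x₁, x₂} : Finset V).card = 5 := by
    simpa using List.toFinset_card_of_nodup hnd
  have := Finset.card_le_card (fun z hz => mem_nbrsIn.2 (hN z hz))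
  omega

/-- A neighbour `p` of `m` of degree four that cannot be recoloured has, apart from its neighbour
`y`, no neighbour with the colour of `y`. -/
lemma CriticalOn.colour_ne_of_stuck (hX : G.CriticalOn X) {m y w p q : V} {c : V → Fin 4}
    (hm : m ∈ X) (hy : y ∈ X) (hp : p ∈ X) (hmp : G.Adj m p) (hyp : G.Adj y p)
    (hpq : p ≠ q) (hpw : p ≠ w) (hmy : m ≠ y)
    (hmN : ∀ x ∈ X, G.Adj m x → x = y ∨ x = w ∨ x = p ∨ x = q)
    (hdp : (G.nbrsIn X p).card ≤ 4) (hc : G.ProperOn (X.erase m) c) :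
    ∀ x ∈ X, G.Adj p x → x ≠ y → x ≠ m → c x ≠ c y := by
  obtain ⟨n1, n2, n3, n4, n5, n6⟩ := four_colours (hX.colours_of_nbrs hm hmN hc)
  -- If `p` could take the colour of `w` or `q`, the neighbours of `m` would no longer show all four
  -- colours. So `p` sees both colours, and `y`, `m` and these two neighbours exhaust its degree.
  have hforce : ∀ e, e = c w ∨ e = c q →
      ∃ x ∈ X, G.Adj p x ∧ x ≠ y ∧ x ≠ m ∧ c x = e := by
    intro e he
    by_contra hcon
    push Not at hcon
    have h1 := hc.insert_of_color (v := p) (e := e) (by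
      intro x hx hpx
      rw [Finset.mem_erase] at hx
      by_cases hxy : x = y
      · rw [hxy]
        rcases he with rfl | rfl
        · exact n1
        · exact n3
      · exact hcon x hx.2 hpx hxy hx.1)
    rw [Finset.insert_eq_self.2 (Finset.mem_erase.2 ⟨hmp.ne.symm, hp⟩)] at h1
    have h2 := four_colours (hX.colours_of_nbrs hm hmN h1)
    rw [Function.update_self, Function.update_of_ne hpq.symm, Function.update_of_ne hpw.symm,
      Function.update_of_ne hyp.ne] at h2
    rcases he with rfl | rfl
    · exact h2.2.2.2.1 rfl
    · exact h2.2.2.2.2.2 rfl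
  obtain ⟨x₁, hx₁, h11, h12, h13, h14⟩ := hforce (c w) (Or.inl rfl)
  obtain ⟨x₂, hx₂, h21, h22, h23, h24⟩ := hforce (c q) (Or.inr rfl)
  intro x hx hpx hxy hxm hcx
  refine false_of_five_nbrs (y := y) (m := m) (x := x) (x₁ := x₁) (x₂ := x₂) hdp ?_ ?_
  · intro z hz
    simp only [Finset.mem_insert, Finset.mem_singleton] at hz
    rcases hz with rfl | rfl | rfl | rfl | rfl
    · exact ⟨hy, hyp.symm⟩
    · exact ⟨hm, hmp.symm⟩
    all_goals exact ⟨by assumption, by assumption⟩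
  · have e1 : x ≠ x₁ := by rintro rfl; exact n1 (hcx.symm.trans h14)
    have e2 : x ≠ x₂ := by rintro rfl; exact n3 (hcx.symm.trans h24)
    have e3 : x₁ ≠ x₂ := by rintro rfl; exact n5 (h14.symm.trans h24)
    simp [hmy.symm, hxy.symm, hxm.symm, h12.symm, h13.symm, h22.symm, h23.symm, e1, e2, e3]

/-- The situation in which a vertex `m` of a critical set has exactly the neighbours `y`, `w`,
`p`, `q`, and `y` and `w` have few further neighbours. -/
lemma CriticalOn.false_of_recolour (hX : G.CriticalOn X) {m y w p q : V} (T : V → Prop)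
    (hm : m ∈ X) (hy : y ∈ X) (hw : w ∈ X) (hp : p ∈ X) (hq : q ∈ X)
    (hmy : G.Adj m y) (hmw : G.Adj m w) (hmp : G.Adj m p) (hmq : G.Adj m q)
    (hyw : G.Adj y w) (hyp : G.Adj y p) (hyq : G.Adj y q) (hpq : ¬ G.Adj p q)
    (hpq' : p ≠ q) (hpw : p ≠ w) (hqw : q ≠ w)
    (hmN : ∀ x ∈ X, G.Adj m x → x = y ∨ x = w ∨ x = p ∨ x = q)
    (hyN : ∀ x ∈ X, G.Adj y x → x = m ∨ x = p ∨ x = q ∨ x = w ∨ T x)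
    (hT : ∀ x ∈ X, T x → G.Adj y x ∧ G.Adj w x) (hTp : ¬ T p) (hTq : ¬ T q)
    (hTw : (∀ a ∈ X, ∀ b ∈ X, T a → T b → a = b) ∨
      ∀ x ∈ X, G.Adj w x → x = y ∨ x = m ∨ T x)
    (hdp : (G.nbrsIn X p).card ≤ 4) (hdq : (G.nbrsIn X q).card ≤ 4) : False := by
  obtain ⟨c, hc⟩ := hX.2 (X.erase m) (Finset.erase_ssubset hm)
  have hne := four_colours (hX.colours_of_nbrs hm hmN hc)
  have hcc : ∀ u ∈ X, ∀ v ∈ X, u ≠ m → v ≠ m → G.Adj u v → c u ≠ c v :=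
    fun u hu v hv hum hvm huv => hc (Finset.mem_erase.2 ⟨hum, hu⟩) (Finset.mem_erase.2 ⟨hvm, hv⟩) huv
  have hextp := hX.colour_ne_of_stuck hm hy hp hmp hyp hpq' hpw hmy.ne hmN hdp hc
  have hextq := hX.colour_ne_of_stuck (w := w) (q := p) hm hy hq hmq hyq hpq'.symm hqw hmy.ne
    (fun x hx hmx => by have := hmN x hx hmx; tauto) hdq hc
  have n1 := hmy.ne
  have n2 := hmw.ne
  have n3 := hmp.ne
  have n4 := hmq.ne
  have n5 := hyw.ne
  have n6 := hyp.ne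
  have n7 := hyq.ne
  have of_half : ∀ c' : V → Fin 4,
      (∀ u ∈ X, ∀ v ∈ X, G.Adj u v → (u = p ∨ u = q ∨ u = y ∨ u = m ∨ u = w) → c' u ≠ c' v) →
      (∀ u, u ≠ p → u ≠ q → u ≠ y → u ≠ m → u ≠ w → c' u = c u) → False := by
    intro c' h1 h2
    refine hX.1 c' ?_
    intro u hu v hv huv
    by_cases hu' : u = p ∨ u = q ∨ u = y ∨ u = m ∨ u = w
    · exact h1 u hu v hv huv hu'
    by_cases hv' : v = p ∨ v = q ∨ v = y ∨ v = m ∨ v = w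
    · exact (h1 v hv u hu huv.symm hv').symm
    push Not at hu' hv'
    rw [h2 u hu'.1 hu'.2.1 hu'.2.2.1 hu'.2.2.2.1 hu'.2.2.2.2,
      h2 v hv'.1 hv'.2.1 hv'.2.2.1 hv'.2.2.2.1 hv'.2.2.2.2]
    exact hcc u hu v hv hu'.2.2.2.1 hv'.2.2.2.1 huv
  -- Moving `p` and `q` to the colour of `y` frees their own two colours, one for `y` and the other
  -- for `m`. This works if `T` misses one of the two colours.
  by_cases hTq' : ∀ x ∈ X, T x → c x ≠ c q
  · refine of_half (fun v => if v = p ∨ v = q then c y else if v = y then c q else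
      if v = m then c p else c v) ?_ ?_
    · intro u hu v hv huv hu'
      have hvu := huv.symm
      have := hcc u hu v hv
      rcases hu' with rfl | rfl | rfl | rfl | rfl
      · have := hextp v hv
        grind
      · have := hextq v hv
        grind
      · have := hyN v hv huv
        grind
      · have := hmN v hv huv
        grind
      · have h1 := hextp u hu
        have h2 := hextq u hu
        have h3 := hyN u hu hyw
        grind
    · intro u; grind
  by_cases hTp' : ∀ x ∈ X, T x → c x ≠ c p
  · refine of_half (fun v => if v = p ∨ v = q then c y else if v = y then c p else
      if v = m then c q else c v) ?_ ?_
    · intro u hu v hv huv hu'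
      have hvu := huv.symm
      have := hcc u hu v hv
      rcases hu' with rfl | rfl | rfl | rfl | rfl
      · have := hextp v hv
        grind
      · have := hextq v hv
        grind
      · have := hyN v hv huv
        grind
      · have := hmN v hv huv
        grind
      · have h1 := hextp u hu
        have h2 := hextq u hu
        have h3 := hyN u hu hyw
        grind
    · intro u; grind
  push Not at hTp' hTq'
  obtain ⟨a, ha, hTa, hca⟩ := hTp'
  obtain ⟨b, hb, hTb, hcb⟩ := hTq'
  have hwN : ∀ x ∈ X, G.Adj w x → x = y ∨ x = m ∨ T x := by
    refine hTw.resolve_left fun h => ?_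
    have := h a ha b hb hTa hTb
    grind
  -- Now `T` has two vertices, so the neighbours of `w` are known. Those in `T` are adjacent to both
  -- `y` and `w` and avoid both their colours, so `y` and `w` can exchange colours. Then `p` takes
  -- the old colour of `y`, and `m` that of `p`.
  refine of_half (fun v => if v = p ∨ v = w then c y else if v = y then c w else
    if v = m then c p else c v) ?_ ?_
  · intro u hu v hv huv hu'
    have hvu := huv.symm
    have := hcc u hu v hv
    rcases hu' with rfl | rfl | rfl | rfl | rfl
    · have := hextp v hv
      have := hwN u hu
      grind
    · have := hextq v hv
      have := hwN u hu
      grind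
    · have := hyN v hv huv
      have := hT v hv
      grind
    · have := hmN v hv huv
      grind
    · have := hwN v hv huv
      have := hT v hv
      grind
  · intro u; grind

end

/-- A graph that is not 4-colourable contains a critical set. -/
lemma exists_criticalOn (h : ¬ G.Colorable 4) : ∃ X, G.CriticalOn X := by
  have hex : ∃ X : Finset V, ∀ c, ¬ G.ProperOn X c := by
    by_contra hcon
    push Not at hcon
    -- Compactness (de Bruijn–Erdős): colourings of all finite subgraphs give one of the whole
    -- graph.
    refine h (nonempty_hom_of_forall_finite_subgraph_hom (F := ⊤) ?_)
    intro G' hG'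
    have hc := (hcon hG'.toFinset).choose_spec
    refine ⟨fun v => (hcon hG'.toFinset).choose v, ?_⟩
    intro a b hab
    exact hc (by simp) (by simp) (G'.coe_adj_sub a b hab)
  obtain ⟨X, hX⟩ := hex
  induction X using Finset.strongInduction with
  | H X ih =>
    by_cases hall : ∀ Y, Y ⊂ X → ∃ c, G.ProperOn Y c
    · exact ⟨X, hX, hall⟩
    · push Not at hall
      obtain ⟨Y, hY, hc⟩ := hall
      exact ih Y hY hc

end SimpleGraph

/-! ### A reducible configuration: two adjacent vertices with four common neighbours -/

namespace SimpleGraph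

variable {V : Type*} {G : SimpleGraph V} {X Y : Finset V}

section

open Classical

lemma ProperOn.of_changed {c c' : V → Fin 4} {E : Finset V} (hc : G.ProperOn (X \ E) c)
    (h₁ : ∀ u ∈ X, ∀ v ∈ X, G.Adj u v → u ∈ E → c' u ≠ c' v) (h₂ : ∀ u ∉ E, c' u = c u) :
    G.ProperOn X c' := by
  intro u hu v hv huv
  by_cases hu' : u ∈ E
  · exact h₁ u hu v hv huv hu'
  by_cases hv' : v ∈ E
  · exact (h₁ v hv u hu huv.symm hv').symm
  rw [h₂ u hu', h₂ v hv']
  exact hc (Finset.mem_sdiff.2 ⟨hu, hu'⟩) (Finset.mem_sdiff.2 ⟨hv, hv'⟩) huv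

/-- Each neighbour inside the uncoloured set `E` lowers by one the bound on the colours forbidden at
`v`. -/
lemma card_image_nbrsIn_sdiff {E F : Finset V} {v : V} (c : V → Fin 4) (hF : F ⊆ E)
    (hFv : ∀ x ∈ F, x ∈ X ∧ G.Adj v x) :
    ((G.nbrsIn (X \ E) v).image c).card + F.card ≤ (G.nbrsIn X v).card := by
  refine (Nat.add_le_add_right Finset.card_image_le _).trans ?_
  rw [← Finset.card_union_of_disjoint]
  · refine Finset.card_le_card (Finset.union_subset (nbrsIn_mono Finset.sdiff_subset v) ?_)
    exact fun x hx => mem_nbrsIn.2 (hFv x hx)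
  · rw [Finset.disjoint_left]
    intro x hx hxF
    exact (Finset.mem_sdiff.1 (mem_nbrsIn.1 hx).1).2 (hF hxF)

lemma exists_two_other_colours (i j : Fin 4) :
    ∃ k l : Fin 4, k ≠ l ∧ k ≠ i ∧ k ≠ j ∧ l ≠ i ∧ l ≠ j := by
  revert i j; decide

/-- A critical set does not contain adjacent vertices `y`, `m` whose other neighbours are four
vertices of degree four forming a subgraph of the kind described. -/
lemma CriticalOn.false_of_adjacent_twins (hX : G.CriticalOn X) {y m p q s t : V}
    (hm : m ∈ X) (hy : y ∈ X) (hp : p ∈ X) (hq : q ∈ X) (hs : s ∈ X) (ht : t ∈ X)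
    (hnd : [y, m, p, q, s, t].Nodup)
    (hyN : ∀ x ∈ X, G.Adj y x → x = m ∨ x = p ∨ x = q ∨ x = s ∨ x = t)
    (hmN : ∀ x ∈ X, G.Adj m x → x = y ∨ x = p ∨ x = q ∨ x = s ∨ x = t)
    (hpN : G.Adj p y ∧ G.Adj p m) (hqN : G.Adj q y ∧ G.Adj q m) (hsN : G.Adj s y ∧ G.Adj s m)
    (htN : G.Adj t y ∧ G.Adj t m)
    (hpq : ¬ G.Adj p q) (hst : ¬ G.Adj s t) (hs₂ : ¬ (G.Adj p s ∧ G.Adj q s))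
    (ht₂ : ¬ (G.Adj p t ∧ G.Adj q t)) (hdp : (G.nbrsIn X p).card ≤ 4)
    (hdq : (G.nbrsIn X q).card ≤ 4) (hds : (G.nbrsIn X s).card ≤ 4)
    (hdt : (G.nbrsIn X t).card ≤ 4) : False := by
  obtain ⟨c, hc⟩ := hX.2 (X.erase m) (Finset.erase_ssubset hm)
  -- All six vertices are uncoloured. Each of `p`, `q`, `s`, `t` has lost `y` and `m`, so at most
  -- two colours are forbidden to it, and one fewer for each further neighbour in `E`.
  obtain ⟨E, hE⟩ : ∃ E : Finset V, E = {y, m, p, q, s, t} := ⟨_, rfl⟩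
  have hcE : G.ProperOn (X \ E) c := hc.mono (by
    intro x hx
    rw [Finset.mem_sdiff, hE] at hx
    simp only [Finset.mem_insert, not_or] at hx
    exact Finset.mem_erase.2 ⟨hx.2.2.1, hx.1⟩)
  simp only [List.nodup_cons, List.mem_cons, List.not_mem_nil, or_false, not_or, not_false_eq_true,
    List.nodup_nil, and_true] at hnd
  obtain ⟨⟨n1, n2, n3, n4, n5⟩, ⟨n6, n7, n8, n9⟩, ⟨n10, n11, n12⟩, ⟨n13, n14⟩, n15⟩ := hnd
  have two : ∀ v, G.Adj v y ∧ G.Adj v m → (G.nbrsIn X v).card ≤ 4 →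
      ((G.nbrsIn (X \ E) v).image c).card ≤ 2 := by
    intro v hv hd
    have := card_image_nbrsIn_sdiff (X := X) (G := G) (v := v) (E := E) (F := {y, m}) c
      (by rw [hE]; intro z; simp only [Finset.mem_insert, Finset.mem_singleton]; tauto)
      (by simp only [Finset.mem_insert, Finset.mem_singleton, forall_eq_or_imp, forall_eq]; tauto)
    rw [Finset.card_pair n1] at this
    omega
  have three : ∀ v z, G.Adj v y ∧ G.Adj v m → (G.nbrsIn X v).card ≤ 4 → G.Adj v z → z ∈ X →
      z ∈ E → z ≠ y → z ≠ m → ((G.nbrsIn (X \ E) v).image c).card ≤ 1 := by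
    intro v z hv hd hvz hz hzE hzy hzm
    have := card_image_nbrsIn_sdiff (X := X) (G := G) (v := v) (E := E) (F := {z, y, m}) c
      (by
        intro x
        simp only [Finset.mem_insert, Finset.mem_singleton]
        rintro (rfl | rfl | rfl)
        · exact hzE
        · simp [hE]
        · simp [hE])
      (by simp only [Finset.mem_insert, Finset.mem_singleton, forall_eq_or_imp, forall_eq]; tauto)
    rw [Finset.card_eq_three.2 ⟨z, y, m, hzy, hzm, n1, rfl⟩] at this
    omega
  have four : ∀ v, G.Adj v y ∧ G.Adj v m → (G.nbrsIn X v).card ≤ 4 → G.Adj v s → G.Adj v t →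
      (G.nbrsIn (X \ E) v).image c = ∅ := by
    intro v hv hd hvs hvt
    have := card_image_nbrsIn_sdiff (X := X) (G := G) (v := v) (E := E) (F := {y, m, s, t}) c
      (by rw [hE]; intro z; simp only [Finset.mem_insert, Finset.mem_singleton]; tauto)
      (by simp only [Finset.mem_insert, Finset.mem_singleton, forall_eq_or_imp, forall_eq]; tauto)
    have h4 : ({y, m, s, t} : Finset V).card = 4 := by
      have : [y, m, s, t].Nodup := by simp [n1, n4, n5, n8, n9, n15]
      simpa using List.toFinset_card_of_nodup this
    rw [← Finset.card_eq_zero]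
    omega
  have hpE : p ∈ E := by simp [hE]
  have hqE : q ∈ E := by simp [hE]
  have hsE : s ∈ E := by simp [hE]
  have htE : t ∈ E := by simp [hE]
  obtain ⟨i, j, a, b, d, e, hij, ha, hb, hd, he, haP, hbQ, hdS, heT, hps, hpt, hqs, hqt⟩ :=
    exists_two_colouring hs₂ ht₂ (two p hpN hdp) (two q hqN hdq) (two s hsN hds) (two t htN hdt)
    (fun h => ⟨three p s hpN hdp h hs hsE (Ne.symm n4) (Ne.symm n8),
      three s p hsN hds h.symm hp hpE (Ne.symm n2) (Ne.symm n6)⟩)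
    (fun h => ⟨three p t hpN hdp h ht htE (Ne.symm n5) (Ne.symm n9),
      three t p htN hdt h.symm hp hpE (Ne.symm n2) (Ne.symm n6)⟩)
    (fun h => ⟨three q s hqN hdq h hs hsE (Ne.symm n4) (Ne.symm n8),
      three s q hsN hds h.symm hq hqE (Ne.symm n3) (Ne.symm n7)⟩)
    (fun h => ⟨three q t hqN hdq h ht htE (Ne.symm n5) (Ne.symm n9),
      three t q htN hdt h.symm hq hqE (Ne.symm n3) (Ne.symm n7)⟩)
    (fun h h' => four p hpN hdp h h') (fun h h' => four q hqN hdq h h')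
  -- As `y` and `m` have no neighbours outside `E`, the two colours unused on `p`, `q`, `s`, `t`
  -- suit them.
  obtain ⟨k, l, hkl, hki, hkj, hli, hlj⟩ := exists_two_other_colours i j
  have other : ∀ x, x = i ∨ x = j → k ≠ x ∧ l ≠ x := by
    rintro x (rfl | rfl)
    · exact ⟨hki, hli⟩
    · exact ⟨hkj, hlj⟩
  have hout : ∀ v e, e ∉ (G.nbrsIn (X \ E) v).image c → ∀ x ∈ X, G.Adj v x → x ∉ E → c x ≠ e := by
    intro v e he x hx hvx hxE hcx
    exact he (Finset.mem_image.2 ⟨x, mem_nbrsIn.2 ⟨Finset.mem_sdiff.2 ⟨hx, hxE⟩, hvx⟩, hcx⟩)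
  have hp' := hout p a haP
  have hq' := hout q b hbQ
  have hs' := hout s d hdS
  have ht' := hout t e heT
  have hmemE : ∀ x, x ∈ E ↔ x = y ∨ x = m ∨ x = p ∨ x = q ∨ x = s ∨ x = t := by simp [hE]
  clear two three four hout haP hbQ hdS heT hdp hdq hds hdt hE hc hpE hqE hsE htE
  obtain ⟨c', hc'⟩ : ∃ c' : V → Fin 4, c' = fun v => if v = p then a else if v = q then b else
    if v = s then d else if v = t then e else if v = y then k else if v = m then l else c v :=
    ⟨_, rfl⟩
  have vp : c' p = a := by grind
  have vq : c' q = b := by grind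
  have vs : c' s = d := by grind
  have vt : c' t = e := by grind
  have vy : c' y = k := by grind
  have vm : c' m = l := by grind
  have vo : ∀ u ∉ E, c' u = c u := by
    intro u hu
    rw [hmemE] at hu
    grind
  clear hc'
  obtain ⟨ka, la⟩ := other a ha
  obtain ⟨kb, lb⟩ := other b hb
  obtain ⟨kd, ld⟩ := other d hd
  obtain ⟨ke, le⟩ := other e he
  refine hX.1 c' (hcE.of_changed ?_ vo)
  intro u hu v hv huv huE
  have hcase : v ∉ E ∨ v = y ∨ v = m ∨ v = p ∨ v = q ∨ v = s ∨ v = t := by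
    rw [← hmemE]; exact (Classical.em _).symm
  rcases (hmemE u).1 huE with rfl | rfl | rfl | rfl | rfl | rfl
  · rcases hyN v hv huv with rfl | rfl | rfl | rfl | rfl
    · rwa [vy, vm]
    · rwa [vy, vp]
    · rwa [vy, vq]
    · rwa [vy, vs]
    · rwa [vy, vt]
  · rcases hmN v hv huv with rfl | rfl | rfl | rfl | rfl
    · rw [vy, vm]; exact hkl.symm
    · rwa [vm, vp]
    · rwa [vm, vq]
    · rwa [vm, vs]
    · rwa [vm, vt]
  · rcases hcase with h | rfl | rfl | rfl | rfl | rfl | rfl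
    · rw [vp, vo v h]; exact (hp' v hv huv h).symm
    · rw [vp, vy]; exact ka.symm
    · rw [vp, vm]; exact la.symm
    · exact absurd huv G.irrefl
    · exact absurd huv hpq
    · rw [vp, vs]; exact hps huv
    · rw [vp, vt]; exact hpt huv
  · rcases hcase with h | rfl | rfl | rfl | rfl | rfl | rfl
    · rw [vq, vo v h]; exact (hq' v hv huv h).symm
    · rw [vq, vy]; exact kb.symm
    · rw [vq, vm]; exact lb.symm
    · exact absurd huv.symm hpq
    · exact absurd huv G.irrefl
    · rw [vq, vs]; exact hqs huv
    · rw [vq, vt]; exact hqt huv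
  · rcases hcase with h | rfl | rfl | rfl | rfl | rfl | rfl
    · rw [vs, vo v h]; exact (hs' v hv huv h).symm
    · rw [vs, vy]; exact kd.symm
    · rw [vs, vm]; exact ld.symm
    · rw [vs, vp]; exact (hps huv.symm).symm
    · rw [vs, vq]; exact (hqs huv.symm).symm
    · exact absurd huv G.irrefl
    · exact absurd huv hst
  · rcases hcase with h | rfl | rfl | rfl | rfl | rfl | rfl
    · rw [vt, vo v h]; exact (ht' v hv huv h).symm
    · rw [vt, vy]; exact ke.symm
    · rw [vt, vm]; exact le.symm
    · rw [vt, vp]; exact (hpt huv.symm).symm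
    · rw [vt, vq]; exact (hqt huv.symm).symm
    · exact absurd huv.symm hst
    · exact absurd huv G.irrefl

end

end SimpleGraph

/-! ### Local structure without `p4` -/

namespace Digraph

variable {V : Type*} {D : Digraph V}

/-- The out-neighbourhood of `v` is `{a, b}`, with `a ≠ b`. -/
def OutPair (D : Digraph V) (v a b : V) : Prop :=
  a ≠ b ∧ D.Adj v a ∧ D.Adj v b ∧ ∀ x, D.Adj v x → x = a ∨ x = b

/-- The out-neighbourhood of `v` is `{a, b, c}`, with `a`, `b`, `c` distinct. -/
def OutTriple (D : Digraph V) (v a b c : V) : Prop :=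
  (a ≠ b ∧ a ≠ c ∧ b ≠ c) ∧ D.Adj v a ∧ D.Adj v b ∧ D.Adj v c ∧
    ∀ x, D.Adj v x → x = a ∨ x = b ∨ x = c

/-- The vertex `v` has exactly two out-neighbours. -/
def IsSmall (D : Digraph V) (v : V) : Prop :=
  ∃ a b, D.OutPair v a b

/-- An oriented digraph with all out-degrees at least two and without a copy of `p4`. -/
structure IsP4Free (D : Digraph V) : Prop where
  oriented : ∀ {x y}, D.Adj x y → ¬ D.Adj y x
  two_le : ∀ v, ∃ a b, a ≠ b ∧ D.Adj v a ∧ D.Adj v b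
  free : ∀ {x y z v w}, D.Adj y x → D.Adj y z → D.Adj v z → D.Adj v w → y ≠ v → x ≠ z →
    w ≠ z → x ≠ v → w ≠ y → x = w

lemma OutPair.symm {v a b : V} (h : D.OutPair v a b) : D.OutPair v b a := by
  unfold OutPair at *; grind

lemma OutPair.isSmall {v a b : V} (h : D.OutPair v a b) : D.IsSmall v := ⟨a, b, h⟩

namespace IsP4Free

/-- All uses of `free` pass through this lemma. Unless the out-neighbours of `y` or `v` are just `z`
and the other vertex, both have exactly one out-neighbour `a` besides. What remains open is an arc
between `y` and `v`, in at most one direction. -/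
lemma pair_cases (h : D.IsP4Free) {y v z : V} (hyv : y ≠ v) (hy : D.Adj y z) (hv : D.Adj v z) :
    D.OutPair y z v ∨ D.OutPair v z y ∨ ∃ a, a ≠ y ∧ a ≠ v ∧
      (D.OutPair y z a ∧ D.OutPair v z a ∨ D.OutPair v z a ∧ D.OutTriple y z a v ∨
        D.OutPair y z a ∧ D.OutTriple v z a y) := by
  have irr : ∀ x, ¬ D.Adj x x := fun x hx => h.oriented hx hx
  by_cases hA : ∃ x, D.Adj y x ∧ x ≠ z ∧ x ≠ v
  swap
  · left
    obtain ⟨a, b, hab, h1, h2⟩ := h.two_le y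
    unfold OutPair
    grind
  by_cases hB : ∃ x, D.Adj v x ∧ x ≠ z ∧ x ≠ y
  swap
  · right; left
    obtain ⟨a, b, hab, h1, h2⟩ := h.two_le v
    unfold OutPair
    grind
  right; right
  obtain ⟨a, ha, haz, hav⟩ := hA
  obtain ⟨b, hb, hbz, hby⟩ := hB
  have key : ∀ x w, D.Adj y x → x ≠ z → x ≠ v → D.Adj v w → w ≠ z → w ≠ y → x = w :=
    fun x w h1 h2 h3 h4 h5 h6 => h.free h1 hy hv h4 hyv h2 h5 h3 h6
  have hab : a = b := key a b ha haz hav hb hbz hby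
  subst hab
  have hA' : ∀ x, D.Adj y x → x = z ∨ x = v ∨ x = a := fun x hx => by
    have := key x a hx; tauto
  have hB' : ∀ x, D.Adj v x → x = z ∨ x = y ∨ x = a := fun x hx => by
    have := key a x ha haz hav hx; tauto
  have ho := @h.oriented y v
  refine ⟨a, hby, hav, ?_⟩
  unfold OutPair OutTriple
  by_cases h1 : D.Adj y v
  · right; left
    grind
  · by_cases h2 : D.Adj v y
    · right; right
      grind
    · left
      grind

lemma not_adj_self (h : D.IsP4Free) (x : V) : ¬ D.Adj x x := fun hx => h.oriented hx hx

lemma big_cases (h : D.IsP4Free) {y v z : V} (hyv : y ≠ v) (hy : D.Adj y z) (hv : D.Adj v z)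
    (hB : ¬ D.IsSmall y) :
    D.OutPair v z y ∨ ∃ a, a ≠ y ∧ a ≠ v ∧ D.OutPair v z a ∧ D.OutTriple y z a v := by
  rcases h.pair_cases hyv hy hv with h1 | h1 | ⟨a, h1, h2, ⟨h3, h4⟩ | ⟨h3, h4⟩ | ⟨h3, h4⟩⟩
  · exact absurd h1.isSmall hB
  · exact Or.inl h1
  · exact absurd h3.isSmall hB
  · exact Or.inr ⟨a, h1, h2, h3, h4⟩
  · exact absurd h3.isSmall hB

/-- A vertex has at most one in-neighbour of out-degree at least three. -/
lemma big_unique (h : D.IsP4Free) {y v z : V} (hy : D.Adj y z) (hv : D.Adj v z)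
    (hBy : ¬ D.IsSmall y) (hBv : ¬ D.IsSmall v) : y = v := by
  by_contra hyv
  rcases h.big_cases hyv hy hv hBy with h1 | ⟨a, -, -, h1, -⟩ <;> exact hBv h1.isSmall

/-- Apply `pair_cases` at `y` to `v₁`, `v₂`: their second out-neighbours agree, since `z₁ = v₂` or
`z₂ = v₁` would give opposite arcs at `y`. -/
lemma back_unique (h : D.IsP4Free) {y z₁ z₂ v₁ v₂ : V} (h1 : D.Adj y z₁) (h2 : D.Adj y z₂)
    (hv1 : D.OutPair v₁ z₁ y) (hv2 : D.OutPair v₂ z₂ y) : z₁ = z₂ := by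
  by_contra hz
  have a1 := hv1.2.2.1
  have a2 := hv2.2.2.1
  have o := @h.oriented
  have hne : v₁ ≠ v₂ := by
    rintro rfl
    have := hv1.2.2.2 z₂ hv2.2.1
    grind
  have hc := h.pair_cases hne a1 a2
  unfold OutPair OutTriple at *
  grind

/-- A vertex `y` with out-neighbourhood `{m, p, q}` such that `m` has out-neighbourhood
`{p, q}`. -/
def _root_.Digraph.Diamond (D : Digraph V) (y m p q : V) : Prop :=
  D.OutTriple y m p q ∧ D.OutPair m p q

/-- By `big_cases`, each of `v`, `w` either points back to `y` or is the middle of a diamond;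
`back_unique` forbids that both point back. -/
lemma exists_diamond (h : D.IsP4Free) {y p q v w : V} (hB : ¬ D.IsSmall y) (hpq : p ≠ q)
    (hp : D.Adj y p) (hq : D.Adj y q) (hv : D.Adj v p) (hvy : v ≠ y) (hw : D.Adj w q)
    (hwy : w ≠ y) : ∃ m a b, D.Diamond y m a b ∧ (m = v ∨ m = w) := by
  unfold Diamond
  rcases h.big_cases hvy.symm hp hv hB with h1 | ⟨a, ha, hav, h1, h2⟩
  · rcases h.big_cases hwy.symm hq hw hB with h3 | ⟨a, ha, hav, h3, h4⟩
    · exact absurd (h.back_unique hp hq h1 h3) hpq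
    · refine ⟨w, q, a, ⟨?_, h3⟩, Or.inr rfl⟩
      unfold OutTriple at *
      grind
  · refine ⟨v, p, a, ⟨?_, h1⟩, Or.inl rfl⟩
    unfold OutTriple at *
    grind

lemma _root_.Digraph.Diamond.swap {y m p q : V} (hd : D.Diamond y m p q) :
    D.Diamond y m q p := by
  unfold Diamond OutTriple OutPair at *
  grind

lemma _root_.Digraph.Diamond.not_isSmall {y m p q : V} (hd : D.Diamond y m p q) :
    ¬ D.IsSmall y := by
  rintro ⟨a, b, h⟩
  unfold Diamond OutTriple OutPair at *
  grind

section Diamond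

variable {y m p q w : V}

/-- The other alternative of `big_cases` puts `w` among `p`, `q`, to which `m` already points. -/
lemma outPair_of_adj_middle (h : D.IsP4Free) (hd : D.Diamond y m p q) {w : V}
    (hw : D.Adj w m) (hwy : w ≠ y) : D.OutPair w m y := by
  have hym : D.Adj y m := hd.1.2.1
  have o := @h.oriented
  rcases h.big_cases hwy.symm hym hw hd.not_isSmall with h1 | ⟨a, -, -, h1, h2⟩
  · exact h1
  · unfold Diamond OutTriple OutPair at *
    grind

/-- A further in-neighbour `u` either points back to `y`, against `back_unique` with the foot `w`,
or is `q` and points to `m`, against the arc from `m` to `q`. -/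
lemma in_side (h : D.IsP4Free) (hd : D.Diamond y m p q) (hw : D.OutPair w m y) {u : V}
    (hu : D.Adj u p) : u = y ∨ u = m := by
  by_contra hc
  push Not at hc
  have hym : D.Adj y m := hd.1.2.1
  have hyp : D.Adj y p := hd.1.2.2.1
  have o := @h.oriented
  rcases h.big_cases hc.1.symm hyp hu hd.not_isSmall with h1 | ⟨a, -, -, h1, h2⟩
  · exact hd.1.1.1 (h.back_unique hym hyp hw h1)
  · unfold Diamond OutTriple OutPair at *
    grind

lemma sides_not_adj (h : D.IsP4Free) (hd : D.Diamond y m p q) (hw : D.OutPair w m y) :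
    ¬ D.Adj p q ∧ ¬ D.Adj q p := by
  have h1 := fun u => @in_side V D y m q p w h hd.swap hw u
  have h2 := fun u => @in_side V D y m p q w h hd hw u
  unfold Diamond OutTriple OutPair at *
  grind

/-- Compare `u` with `w` by `pair_cases` at `y`. If `u` had three out-neighbours it would point to
`m`, and `outPair_of_adj_middle` would make it small. -/
lemma in_apex (h : D.IsP4Free) (hd : D.Diamond y m p q) (hw : D.OutPair w m y) {u : V}
    (hu : D.Adj u y) : D.OutPair u m y ∨ D.OutPair u y w := by
  by_cases huw : u = w
  · subst huw; exact Or.inl hw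
  have hwy : D.Adj w y := hw.2.2.1
  have hym : D.Adj y m := hd.1.2.1
  have hm : D.IsSmall m := hd.2.isSmall
  have o := @h.oriented
  rcases h.pair_cases huw hu hwy with h1 | h1 | ⟨a, h1, h2, ⟨h3, h4⟩ | ⟨h3, h4⟩ | ⟨h3, h4⟩⟩
  · exact Or.inr h1
  · exfalso
    unfold Diamond OutTriple OutPair at *
    grind
  · left
    unfold Diamond OutTriple OutPair at *
    grind
  · exfalso
    have hum : D.Adj u m := by
      unfold Diamond OutTriple OutPair at *
      grind
    have : u = y := by
      by_contra hne
      have := h.outPair_of_adj_middle hd hum hne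
      unfold Diamond OutTriple OutPair at *
      grind
    subst this
    exact h.not_adj_self _ hu
  · exfalso
    unfold Diamond OutTriple OutPair at *
    grind

lemma in_apex_small (h : D.IsP4Free) (hd : D.Diamond y m p q) (hw : D.OutPair w m y) {u : V}
    (hu : D.Adj u y) : D.IsSmall u := by
  rcases h.in_apex hd hw hu with h1 | h1 <;> exact h1.isSmall

/-- Comparison with `s` alone leaves the exception that `u` points to `w` and `s`; comparison with
`t` excludes it. -/
lemma in_base (h : D.IsP4Free) (hd : D.Diamond y m p q) (hw : D.OutPair w m y) {s t u : V}
    (hs : D.OutPair s y w) (ht : D.OutPair t y w) (hst : s ≠ t) (hu : D.Adj u w) :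
    D.OutPair u y w := by
  by_cases hus : u = s
  · subst hus; exact hs
  by_cases hut : u = t
  · subst hut; exact ht
  have hsw : D.Adj s w := hs.2.2.1
  have htw : D.Adj t w := ht.2.2.1
  have o := @h.oriented
  have h1 := h.pair_cases hus hu hsw
  have h2 := h.pair_cases hut hu htw
  have h3 := fun hu => @in_apex V D y m p q w h hd hw u hu
  unfold OutPair OutTriple at *
  grind

lemma sides_twin (h : D.IsP4Free) (hd : D.Diamond y m p q) (hw : D.OutPair w m y) {z : V}
    (hp : D.Adj p z) (hq : D.Adj q z) (x : V) : D.Adj p x ↔ D.Adj q x := by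
  have h1 := h.sides_not_adj hd hw
  have hpq : p ≠ q := hd.2.1
  have h2 := h.pair_cases hpq hp hq
  unfold OutPair OutTriple at *
  grind

end Diamond

/-- A vertex pointing into the sink of a transitive triangle whose other two vertices are
small is an out-twin of the source of the triangle. -/
lemma outPair_of_triangle (h : D.IsP4Free) {y v z g u : V} (hy : D.OutPair y z v)
    (hv : D.OutPair v z g) (hu : D.Adj u z) (huy : u ≠ y) (huv : u ≠ v) (hvu : ¬ D.Adj v u) :
    D.OutPair u z v := by
  have o := @h.oriented
  have hyz : D.Adj y z := hy.2.1
  have hvz : D.Adj v z := hv.2.1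
  have h1 := h.pair_cases huy hu hyz
  have h2 := h.pair_cases huv hu hvz
  unfold OutPair OutTriple at *
  grind

end IsP4Free

end Digraph

/-! ### Arcs and diamonds inside a critical set -/

namespace Digraph

variable {V : Type*} {D : Digraph V} {X : Finset V}

section

open Classical

/-- The out-neighbours of `v` in the finite set `X`. -/
noncomputable def outIn (D : Digraph V) (X : Finset V) (v : V) : Finset V :=
  X.filter (D.Adj v)

/-- The in-neighbours of `v` in the finite set `X`. -/
noncomputable def inIn (D : Digraph V) (X : Finset V) (v : V) : Finset V :=
  X.filter fun u => D.Adj u v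

/-- The vertices of `X` with exactly two out-neighbours. -/
noncomputable def smallIn (D : Digraph V) (X : Finset V) : Finset V :=
  X.filter D.IsSmall

/-- The vertices of `X` with more than two out-neighbours. -/
noncomputable def bigIn (D : Digraph V) (X : Finset V) : Finset V :=
  X.filter fun v => ¬ D.IsSmall v

@[simp] lemma mem_outIn {u v : V} : u ∈ D.outIn X v ↔ u ∈ X ∧ D.Adj v u := by simp [outIn]

@[simp] lemma mem_inIn {u v : V} : u ∈ D.inIn X v ↔ u ∈ X ∧ D.Adj u v := by simp [inIn]

@[simp] lemma mem_smallIn {v : V} : v ∈ D.smallIn X ↔ v ∈ X ∧ D.IsSmall v := by simp [smallIn]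

@[simp] lemma mem_bigIn {v : V} : v ∈ D.bigIn X ↔ v ∈ X ∧ ¬ D.IsSmall v := by simp [bigIn]

lemma sum_outIn_eq_sum_inIn (D : Digraph V) (X Y : Finset V) :
    ∑ v ∈ X, (D.outIn Y v).card = ∑ v ∈ Y, (D.inIn X v).card :=
  Finset.sum_card_bipartiteAbove_eq_sum_card_bipartiteBelow D.Adj

lemma OutPair.card_outIn_le {v a b : V} (h : D.OutPair v a b) : (D.outIn X v).card ≤ 2 := by
  refine (Finset.card_le_card (fun x hx => ?_)).trans (Finset.card_le_two (a := a) (b := b))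
  simpa using h.2.2.2 x (mem_outIn.1 hx).2

lemma IsSmall.card_outIn_le {v : V} (h : D.IsSmall v) : (D.outIn X v).card ≤ 2 := by
  obtain ⟨a, b, h⟩ := h
  exact h.card_outIn_le

lemma OutPair.mem_of_two_le {v a b : V} (h : D.OutPair v a b) (h2 : 2 ≤ (D.outIn X v).card) :
    a ∈ X ∧ b ∈ X := by
  have hsub : D.outIn X v ⊆ {a, b} := fun x hx => by
    simpa using h.2.2.2 x (mem_outIn.1 hx).2
  have heq := Finset.eq_of_subset_of_card_le hsub (Finset.card_le_two.trans h2)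
  have ha : a ∈ D.outIn X v := by rw [heq]; simp
  have hb : b ∈ D.outIn X v := by rw [heq]; simp
  exact ⟨(mem_outIn.1 ha).1, (mem_outIn.1 hb).1⟩

lemma card_outIn_smallIn_add_bigIn (v : V) :
    (D.outIn (D.smallIn X) v).card + (D.outIn (D.bigIn X) v).card = (D.outIn X v).card := by
  rw [← Finset.card_union_of_disjoint]
  · congr 1
    ext x
    simp only [Finset.mem_union, mem_outIn, mem_smallIn, mem_bigIn]
    tauto
  · rw [Finset.disjoint_left]
    intro x hx hx'
    simp only [mem_outIn, mem_smallIn, mem_bigIn] at hx hx'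
    tauto

namespace IsP4Free

lemma adj_iff (h : D.IsP4Free) {u v : V} : D.underlying.Adj u v ↔ D.Adj u v ∨ D.Adj v u := by
  rw [underlying, toSimpleGraphInclusive, SimpleGraph.fromRel_adj]
  refine ⟨And.right, fun hor => ⟨?_, hor⟩⟩
  rintro rfl
  exact h.not_adj_self u (hor.elim id id)

lemma card_nbrsIn (h : D.IsP4Free) (v : V) :
    (D.underlying.nbrsIn X v).card = (D.outIn X v).card + (D.inIn X v).card := by
  rw [← Finset.card_union_of_disjoint]
  · congr 1
    ext x
    simp only [SimpleGraph.mem_nbrsIn, h.adj_iff, Finset.mem_union, mem_outIn, mem_inIn]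
    tauto
  · rw [Finset.disjoint_left]
    intro x hx hx'
    exact h.oriented (mem_outIn.1 hx).2 (mem_inIn.1 hx').2

lemma card_inIn_bigIn_le (h : D.IsP4Free) (v : V) : (D.inIn (D.bigIn X) v).card ≤ 1 := by
  rw [Finset.card_le_one]
  intro a ha b hb
  simp only [mem_inIn, mem_bigIn] at ha hb
  exact h.big_unique ha.2 hb.2 ha.1.2 hb.1.2

lemma exists_inIn_ne (h : D.IsP4Free) (hX : D.underlying.CriticalOn X) {v : V} (hv : v ∈ X)
    (hs : D.IsSmall v) (y : V) : ∃ u ∈ X, D.Adj u v ∧ u ≠ y := by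
  have h1 := hX.four_le hv
  have h2 := hs.card_outIn_le (X := X)
  rw [h.card_nbrsIn] at h1
  obtain ⟨u, hu, huy⟩ := Finset.exists_mem_ne (s := D.inIn X v) (by omega) y
  rw [mem_inIn] at hu
  exact ⟨u, hu.1, hu.2, huy⟩

/-- A big vertex with two small out-neighbours in a critical set is the apex of a diamond. -/
lemma exists_diamond_of_two_le (h : D.IsP4Free) (hX : D.underlying.CriticalOn X) {y : V}
    (hy : ¬ D.IsSmall y) (h2 : 2 ≤ (D.outIn (D.smallIn X) y).card) :
    ∃ m p q w, D.Diamond y m p q ∧ m ∈ X ∧ w ∈ X ∧ D.OutPair w m y := by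
  obtain ⟨p, hp, q, hq, hpq⟩ := Finset.one_lt_card.1 h2
  simp only [mem_outIn, mem_smallIn] at hp hq
  obtain ⟨v, hv, hvp, hvy⟩ := h.exists_inIn_ne hX hp.1.1 hp.1.2 y
  obtain ⟨w, hw, hwq, hwy⟩ := h.exists_inIn_ne hX hq.1.1 hq.1.2 y
  obtain ⟨m, a, b, hd, hm⟩ := h.exists_diamond hy hpq hp.2 hq.2 hvp hvy hwq hwy
  have hmX : m ∈ X := by rcases hm with rfl | rfl <;> assumption
  obtain ⟨u, hu, hum, huy⟩ := h.exists_inIn_ne hX hmX hd.2.isSmall y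
  exact ⟨m, a, b, u, hd, hmX, hu, h.outPair_of_adj_middle hd hum huy⟩

/-- A diamond all of whose vertices lie in `X` and have, apart from the apex, out-degree two. -/
def _root_.Digraph.DiamondIn (D : Digraph V) (X : Finset V) (y m p q : V) : Prop :=
  D.Diamond y m p q ∧ y ∈ X ∧ m ∈ X ∧ p ∈ X ∧ q ∈ X ∧ D.IsSmall p ∧ D.IsSmall q

lemma exists_diamondIn_of_three_le (h : D.IsP4Free) (hX : D.underlying.CriticalOn X) {y : V}
    (hyX : y ∈ X) (hy : ¬ D.IsSmall y) (h3 : 3 ≤ (D.outIn (D.smallIn X) y).card) :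
    ∃ m p q, D.DiamondIn X y m p q := by
  obtain ⟨m, p, q, w, hd, hm, -, -⟩ := h.exists_diamond_of_two_le hX hy (by omega)
  have hsub : D.outIn (D.smallIn X) y ⊆ {m, p, q} := fun x hx => by
    simpa using hd.1.2.2.2.2 x (mem_outIn.1 hx).2
  have heq := Finset.eq_of_subset_of_card_le hsub (Finset.card_le_three.trans h3)
  have hp : p ∈ D.outIn (D.smallIn X) y := by rw [heq]; simp
  have hq : q ∈ D.outIn (D.smallIn X) y := by rw [heq]; simp
  simp only [mem_outIn, mem_smallIn] at hp hq
  exact ⟨m, p, q, hd, hyX, hm, hp.1.1, hq.1.1, hp.1.2, hq.1.2⟩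

/-- Bounds the charge of a big vertex. With two small out-neighbours it is the apex of a diamond
with a foot, so all its in-neighbours are small; otherwise both summands are at most one. -/
lemma card_add_le (h : D.IsP4Free) (hX : D.underlying.CriticalOn X) {y : V}
    (hy : ¬ D.IsSmall y) :
    (D.outIn (D.smallIn X) y).card + (D.inIn (D.bigIn X) y).card ≤
      2 + if 3 ≤ (D.outIn (D.smallIn X) y).card then 1 else 0 := by
  have h1 := h.card_inIn_bigIn_le (X := X) y
  by_cases h2 : 2 ≤ (D.outIn (D.smallIn X) y).card
  · obtain ⟨m, p, q, w, hd, -, -, hw⟩ := h.exists_diamond_of_two_le hX hy h2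
    have h3 : (D.inIn (D.bigIn X) y).card = 0 := by
      rw [Finset.card_eq_zero, Finset.eq_empty_iff_forall_notMem]
      intro u hu
      simp only [mem_inIn, mem_bigIn] at hu
      exact hu.1.2 (h.in_apex_small hd hw hu.2)
    have h4 : (D.outIn (D.smallIn X) y).card ≤ 3 := by
      refine (Finset.card_le_card (fun x hx => ?_)).trans
        (Finset.card_le_three (a := m) (b := p) (c := q))
      simpa using hd.1.2.2.2.2 x (mem_outIn.1 hx).2
    split_ifs <;> omega
  · split_ifs <;> omega

lemma side_degree_le (h : D.IsP4Free) {y m p q w : V} (hd : D.Diamond y m p q)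
    (hw : D.OutPair w m y) (hp : D.IsSmall p) : (D.underlying.nbrsIn X p).card ≤ 4 := by
  rw [h.card_nbrsIn]
  have h1 := hp.card_outIn_le (X := X)
  have h2 : (D.inIn X p).card ≤ 2 := by
    refine (Finset.card_le_card (fun x hx => ?_)).trans (Finset.card_le_two (a := y) (b := m))
    simpa using h.in_side hd hw (mem_inIn.1 hx).2
  omega

/-- In a critical set the middle vertex of a diamond has two in-neighbours besides the apex. -/
lemma exists_two_feet (h : D.IsP4Free) (hX : D.underlying.CriticalOn X) {y m p q : V}
    (hd : D.DiamondIn X y m p q) :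
    ∃ s ∈ X, ∃ t ∈ X, s ≠ t ∧ D.OutPair s m y ∧ D.OutPair t m y := by
  obtain ⟨hd, hy, hm, hp, hq, hps, hqs⟩ := hd
  obtain ⟨w, hw, hwm, hwy⟩ := h.exists_inIn_ne hX hm hd.2.isSmall y
  have hwo := h.outPair_of_adj_middle hd hwm hwy
  refine ⟨w, hw, ?_⟩
  by_contra hcon
  push Not at hcon
  have huniq : ∀ x ∈ X, D.OutPair x m y → x = w := by
    intro x hx hxo
    by_contra hne
    exact hcon x hx (Ne.symm hne) hwo hxo
  have o := @h.oriented
  have hym : D.Adj y m := hd.1.2.1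
  have hyp : D.Adj y p := hd.1.2.2.1
  have hyq : D.Adj y q := hd.1.2.2.2.1
  have hmp : D.Adj m p := hd.2.2.1
  have hmq : D.Adj m q := hd.2.2.2.1
  have hpq := h.sides_not_adj hd hwo
  have hwya : D.Adj w y := hwo.2.2.1
  -- With a single foot `w`, the remaining neighbours `T` of `y` have out-neighbourhood `{y, w}`. If
  -- `T` has two members in `X`, `in_base` determines the in-neighbours of `w`.
  refine hX.false_of_recolour (m := m) (y := y) (w := w) (p := p) (q := q)
    (fun x => D.OutPair x y w) hm hy hw hp hq (h.adj_iff.2 (Or.inr hym)) (h.adj_iff.2 (Or.inr hwm))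
    (h.adj_iff.2 (Or.inl hmp)) (h.adj_iff.2 (Or.inl hmq)) (h.adj_iff.2 (Or.inr hwya))
    (h.adj_iff.2 (Or.inl hyp)) (h.adj_iff.2 (Or.inl hyq)) ?_ hd.2.1 ?_ ?_ ?_ ?_ ?_ ?_ ?_ ?_
    (h.side_degree_le hd hwo hps) (h.side_degree_le hd.swap hwo hqs)
  · rw [h.adj_iff]; tauto
  · rintro rfl; exact o hyp hwya
  · rintro rfl; exact o hyq hwya
  · intro x hx hmx
    rcases h.adj_iff.1 hmx with h1 | h1
    · have := hd.2.2.2.2 x h1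
      tauto
    · by_cases hxy : x = y
      · exact Or.inl hxy
      · exact Or.inr (Or.inl (huniq x hx (h.outPair_of_adj_middle hd h1 hxy)))
  · intro x hx hyx
    rcases h.adj_iff.1 hyx with h1 | h1
    · have := hd.1.2.2.2.2 x h1
      tauto
    · rcases h.in_apex hd hwo h1 with h2 | h2
      · have := huniq x hx h2
        tauto
      · tauto
  · intro x _ hxT
    exact ⟨h.adj_iff.2 (Or.inr hxT.2.1), h.adj_iff.2 (Or.inr hxT.2.2.1)⟩
  · exact fun hT => o hyp hT.2.1
  · exact fun hT => o hyq hT.2.1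
  · rw [or_iff_not_imp_left]
    intro hne x hx hwx
    push Not at hne
    obtain ⟨a, -, b, -, ha, hb, hab⟩ := hne
    rcases h.adj_iff.1 hwx with h1 | h1
    · have := hwo.2.2.2 x h1
      tauto
    · exact Or.inr (Or.inr (h.in_base hd hwo ha hb hab h1))

lemma feet_nodup (h : D.IsP4Free) {y m p q s t : V} (hd : D.Diamond y m p q)
    (hs : D.OutPair s m y) (ht : D.OutPair t m y) (hst : s ≠ t) : [y, m, p, q, s, t].Nodup := by
  have o := @h.oriented
  have i := h.not_adj_self
  simp only [List.nodup_cons, List.mem_cons, List.not_mem_nil, or_false, not_or, not_false_eq_true,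
    List.nodup_nil, and_true]
  unfold Diamond OutTriple OutPair at *
  grind

lemma five_le_apex (h : D.IsP4Free) (hX : D.underlying.CriticalOn X) {y m p q : V}
    (hd : D.DiamondIn X y m p q) :
    5 ≤ (D.underlying.nbrsIn X y).card ∧ 5 ≤ (D.underlying.nbrsIn X m).card := by
  obtain ⟨s, hs, t, ht, hst, hso, hto⟩ := h.exists_two_feet hX hd
  obtain ⟨hd, hy, hm, hp, hq, hps, hqs⟩ := hd
  have hnd := h.feet_nodup hd hso hto hst
  constructor
  · have h1 : [m, p, q, s, t].Nodup := (List.nodup_cons.1 hnd).2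
    rw [← show [m, p, q, s, t].length = 5 from rfl, ← List.toFinset_card_of_nodup h1]
    refine Finset.card_le_card fun x hx => ?_
    rw [SimpleGraph.mem_nbrsIn, h.adj_iff]
    simp only [List.mem_toFinset, List.mem_cons, List.not_mem_nil, or_false] at hx
    rcases hx with rfl | rfl | rfl | rfl | rfl
    · exact ⟨hm, Or.inl hd.1.2.1⟩
    · exact ⟨hp, Or.inl hd.1.2.2.1⟩
    · exact ⟨hq, Or.inl hd.1.2.2.2.1⟩
    · exact ⟨hs, Or.inr hso.2.2.1⟩
    · exact ⟨ht, Or.inr hto.2.2.1⟩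
  · have h1 : [y, p, q, s, t].Nodup :=
      hnd.sublist ((List.sublist_cons_self m _).cons_cons y)
    rw [← show [y, p, q, s, t].length = 5 from rfl, ← List.toFinset_card_of_nodup h1]
    refine Finset.card_le_card fun x hx => ?_
    rw [SimpleGraph.mem_nbrsIn, h.adj_iff]
    simp only [List.mem_toFinset, List.mem_cons, List.not_mem_nil, or_false] at hx
    rcases hx with rfl | rfl | rfl | rfl | rfl
    · exact ⟨hy, Or.inr hd.1.2.1⟩
    · exact ⟨hp, Or.inl hd.2.2.1⟩
    · exact ⟨hq, Or.inl hd.2.2.2.1⟩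
    · exact ⟨hs, Or.inr hso.2.1⟩
    · exact ⟨ht, Or.inr hto.2.1⟩

/-- Degree five leaves `y` only `m`, `p`, `q` and two feet as neighbours, and every foot of `m` is a
neighbour of `y`. No foot is joined to both sides, as `sides_twin` would then give `p` and `q`
nested neighbourhoods. Thus `false_of_adjacent_twins` applies. -/
lemma false_of_low_diamond (h : D.IsP4Free) (hX : D.underlying.CriticalOn X) {y m p q : V}
    (hd : D.DiamondIn X y m p q) (hdy : (D.underlying.nbrsIn X y).card ≤ 5)
    (hlow : ∀ w ∈ X, D.OutPair w m y → (D.underlying.nbrsIn X w).card ≤ 4) : False := by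
  obtain ⟨s, hs, t, ht, hst, hso, hto⟩ := h.exists_two_feet hX hd
  obtain ⟨hd, hy, hm, hp, hq, hps, hqs⟩ := hd
  have hnd := h.feet_nodup hd hso hto hst
  have h1 : [m, p, q, s, t].Nodup := (List.nodup_cons.1 hnd).2
  have a1 := h.adj_iff.2 (Or.inl hd.1.2.1)
  have a2 := h.adj_iff.2 (Or.inl hd.1.2.2.1)
  have a3 := h.adj_iff.2 (Or.inl hd.1.2.2.2.1)
  have a4 := h.adj_iff.2 (Or.inl hd.2.2.1)
  have a5 := h.adj_iff.2 (Or.inl hd.2.2.2.1)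
  have hyN : ∀ x ∈ X, D.underlying.Adj y x → x = m ∨ x = p ∨ x = q ∨ x = s ∨ x = t := by
    have hsub : [m, p, q, s, t].toFinset ⊆ D.underlying.nbrsIn X y := by
      intro x hx
      rw [SimpleGraph.mem_nbrsIn]
      simp only [List.mem_toFinset, List.mem_cons, List.not_mem_nil, or_false] at hx
      rcases hx with rfl | rfl | rfl | rfl | rfl
      · exact ⟨hm, a1⟩
      · exact ⟨hp, a2⟩
      · exact ⟨hq, a3⟩
      · exact ⟨hs, h.adj_iff.2 (Or.inr hso.2.2.1)⟩
      · exact ⟨ht, h.adj_iff.2 (Or.inr hto.2.2.1)⟩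
    have heq := Finset.eq_of_subset_of_card_le hsub (by
      rw [List.toFinset_card_of_nodup h1]; exact hdy)
    intro x hx hyx
    have : x ∈ [m, p, q, s, t].toFinset := by
      rw [heq, SimpleGraph.mem_nbrsIn]
      exact ⟨hx, hyx⟩
    simpa using this
  have hmN : ∀ x ∈ X, D.underlying.Adj m x → x = y ∨ x = p ∨ x = q ∨ x = s ∨ x = t := by
    intro x hx hmx
    rcases h.adj_iff.1 hmx with h2 | h2
    · have := hd.2.2.2.2 x h2
      tauto
    · by_cases hxy : x = y
      · exact Or.inl hxy
      · have h3 := h.outPair_of_adj_middle hd h2 hxy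
        rcases hyN x hx (h.adj_iff.2 (Or.inr h3.2.2.1)) with h4 | h4
        · exact absurd (h4 ▸ h2) (h.not_adj_self m)
        · exact Or.inr h4
  have hpq := h.sides_not_adj hd hso
  have hfoot : ∀ w ∈ X, D.OutPair w m y → ¬ (D.underlying.Adj p w ∧ D.underlying.Adj q w) := by
    rintro w hw hwo ⟨hpw, hqw⟩
    have o := @h.oriented
    have hpw' : D.Adj p w := by
      rcases h.adj_iff.1 hpw with h2 | h2
      · exact h2
      · rcases hwo.2.2.2 p h2 with h3 | h3
        · exact absurd (h3 ▸ hd.2.2.1) (h.not_adj_self _)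
        · exact absurd (h3 ▸ hd.1.2.2.1) (h.not_adj_self _)
    have hqw' : D.Adj q w := by
      rcases h.adj_iff.1 hqw with h2 | h2
      · exact h2
      · rcases hwo.2.2.2 q h2 with h3 | h3
        · exact absurd (h3 ▸ hd.2.2.2.1) (h.not_adj_self _)
        · exact absurd (h3 ▸ hd.1.2.2.2.1) (h.not_adj_self _)
    have htw := h.sides_twin hd hwo hpw' hqw'
    refine hX.not_nbrsIn_subset hp hq hd.2.1 ?_
    intro x _ hpx
    rcases h.adj_iff.1 hpx with h2 | h2
    · exact h.adj_iff.2 (Or.inl ((htw x).1 h2))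
    · rcases h.in_side hd hwo h2 with rfl | rfl
      · exact a3.symm
      · exact a5.symm
  refine hX.false_of_adjacent_twins hm hy hp hq hs ht hnd hyN hmN ⟨a2.symm, a4.symm⟩
    ⟨a3.symm, a5.symm⟩ ⟨h.adj_iff.2 (Or.inl hso.2.2.1), h.adj_iff.2 (Or.inl hso.2.1)⟩
    ⟨h.adj_iff.2 (Or.inl hto.2.2.1), h.adj_iff.2 (Or.inl hto.2.1)⟩ ?_ ?_ (hfoot s hs hso)
    (hfoot t ht hto) (h.side_degree_le hd hso hps) (h.side_degree_le hd.swap hso hqs)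
    (hlow s hs hso) (hlow t ht hto)
  · rw [h.adj_iff]; tauto
  · rw [h.adj_iff]
    have i := h.not_adj_self
    unfold OutPair at hso hto
    clear hyN hmN hfoot hlow
    simp only [List.nodup_cons, List.mem_cons, List.not_mem_nil, or_false, not_or] at hnd
    grind

end IsP4Free

end

end Digraph

/-! ### The degree count, the regular tournament, and the conclusion -/

namespace Digraph

variable {V : Type*} {D : Digraph V} {X : Finset V}

section

open Classical

namespace IsP4Free

/-- Arcs between big vertices are charged to their heads, where `big_unique` limits them to one
each. -/
lemma sum_card_outIn (X : Finset V) :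
    ∑ v ∈ X, (D.outIn X v).card = ∑ v ∈ X, if D.IsSmall v then (D.outIn X v).card else
      (D.outIn (D.smallIn X) v).card + (D.inIn (D.bigIn X) v).card := by
  rw [Finset.sum_ite]
  change _ = ∑ v ∈ D.smallIn X, _ + ∑ v ∈ D.bigIn X, _
  rw [Finset.sum_add_distrib]
  have h1 : ∑ v ∈ D.bigIn X, (D.inIn (D.bigIn X) v).card =
      ∑ v ∈ D.bigIn X, (D.outIn (D.bigIn X) v).card := (sum_outIn_eq_sum_inIn D _ _).symm
  rw [h1, ← Finset.sum_add_distrib]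
  simp only [card_outIn_smallIn_add_bigIn]
  exact (Finset.sum_filter_add_sum_filter_not X D.IsSmall _).symm

/-- In a critical set all degrees are four, and the out-degrees are as large as they can be. -/
lemma degrees_eq (h : D.IsP4Free) (hX : D.underlying.CriticalOn X) :
    (∀ v ∈ X, (D.underlying.nbrsIn X v).card = 4) ∧
      (∀ v ∈ X, D.IsSmall v → (D.outIn X v).card = 2) ∧
      ∀ v ∈ X, ¬ D.IsSmall v →
        (D.outIn (D.smallIn X) v).card + (D.inIn (D.bigIn X) v).card = 2 := by
  obtain ⟨Y, hY⟩ : ∃ Y, Y = (D.bigIn X).filter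
    fun y => 3 ≤ (D.outIn (D.smallIn X) y).card := ⟨_, rfl⟩
  have hYmem : ∀ y, y ∈ Y ↔ (y ∈ X ∧ ¬ D.IsSmall y) ∧ 3 ≤ (D.outIn (D.smallIn X) y).card := by
    intro y; rw [hY, Finset.mem_filter, mem_bigIn]
  have hYX : Y ⊆ X := fun y hy => ((hYmem y).1 hy).1.1
  have hdia : ∀ y, ∃ m p q, y ∈ Y → D.DiamondIn X y m p q := by
    intro y
    by_cases hy : y ∈ Y
    · obtain ⟨⟨h1, h2⟩, h3⟩ := (hYmem y).1 hy
      obtain ⟨m, p, q, hd⟩ := h.exists_diamondIn_of_three_le hX h1 h2 h3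
      exact ⟨m, p, q, fun _ => hd⟩
    · exact ⟨y, y, y, fun hy' => absurd hy' hy⟩
  choose m p q hd using hdia
  have hinj : Set.InjOn m Y := by
    intro y hy z hz hyz
    have h1 := (hd y hy).1.1.2.1
    have h2 := (hd z hz).1.1.2.1
    rw [hyz] at h1
    exact h.big_unique h1 h2 ((hYmem y).1 hy).1.2 ((hYmem z).1 hz).1.2
  have hMcard : (Y.image m).card = Y.card := Finset.card_image_of_injOn hinj
  have hMX : Y.image m ⊆ X := by
    intro x hx
    obtain ⟨y, hy, rfl⟩ := Finset.mem_image.1 hx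
    exact (hd y hy).2.2.1
  have hMsmall : ∀ x ∈ Y.image m, D.IsSmall x := by
    intro x hx
    obtain ⟨y, hy, rfl⟩ := Finset.mem_image.1 hx
    exact (hd y hy).1.2.isSmall
  let f : V → ℕ := fun v => if D.IsSmall v then (D.outIn X v).card else
    (D.outIn (D.smallIn X) v).card + (D.inIn (D.bigIn X) v).card
  have hf : ∀ v ∈ X, f v ≤ 2 + if v ∈ Y then 1 else 0 := by
    intro v hv
    simp only [f]
    by_cases hs : D.IsSmall v
    · rw [if_pos hs]
      exact (hs.card_outIn_le).trans (Nat.le_add_right _ _)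
    · rw [if_neg hs]
      have := h.card_add_le hX hs
      have hiff : v ∈ Y ↔ 3 ≤ (D.outIn (D.smallIn X) v).card := by
        rw [hYmem]; tauto
      simpa only [hiff] using this
  have hg : ∀ v ∈ X, (4 + if v ∈ Y then 1 else 0) + (if v ∈ Y.image m then 1 else 0) ≤
      (D.underlying.nbrsIn X v).card := by
    intro v hv
    by_cases h1 : v ∈ Y
    · have h2 : v ∉ Y.image m := fun h2 => ((hYmem v).1 h1).1.2 (hMsmall v h2)
      rw [if_pos h1, if_neg h2]
      exact (h.five_le_apex hX (hd v h1)).1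
    · rw [if_neg h1]
      by_cases h2 : v ∈ Y.image m
      · rw [if_pos h2]
        obtain ⟨y, hy, rfl⟩ := Finset.mem_image.1 h2
        exact (h.five_le_apex hX (hd y hy)).2
      · rw [if_neg h2]
        exact hX.four_le hv
  have hsumdeg : ∑ v ∈ X, (D.underlying.nbrsIn X v).card = 2 * ∑ v ∈ X, f v := by
    simp only [h.card_nbrsIn, Finset.sum_add_distrib]
    rw [← sum_outIn_eq_sum_inIn D X X, sum_card_outIn X]
    ring
  have e1 : ∑ v ∈ X, (if v ∈ Y then 1 else 0) = Y.card := by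
    rw [Finset.sum_boole, Finset.filter_mem_eq_inter, Finset.inter_eq_right.2 hYX, Nat.cast_id]
  have e2 : ∑ v ∈ X, (if v ∈ Y.image m then 1 else 0) = Y.card := by
    rw [Finset.sum_boole, Finset.filter_mem_eq_inter, Finset.inter_eq_right.2 hMX, Nat.cast_id,
      hMcard]
  have hsumf := Finset.sum_le_sum hf
  have hsumg := Finset.sum_le_sum hg
  have hS1 : ∑ v ∈ X, (2 + if v ∈ Y then 1 else 0) = 2 * X.card + Y.card := by
    rw [Finset.sum_add_distrib, e1, Finset.sum_const, smul_eq_mul, mul_comm]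
  have hS2 : ∑ v ∈ X, ((4 + if v ∈ Y then 1 else 0) + (if v ∈ Y.image m then 1 else 0)) =
      4 * X.card + Y.card + Y.card := by
    rw [Finset.sum_add_distrib, Finset.sum_add_distrib, e1, e2, Finset.sum_const, smul_eq_mul,
      mul_comm]
  -- Twice the upper bound `2 * X.card + Y.card` on the arcs is exactly the lower bound on the
  -- degree sum, so every termwise inequality is an equality.
  have hfeq := (Finset.sum_eq_sum_iff_of_le hf).1 (by omega)
  have hgeq := (Finset.sum_eq_sum_iff_of_le hg).1 (by omega)
  have hYempty : ∀ y, y ∉ Y := by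
    intro y hy
    have hyd := hgeq y (hYX hy)
    rw [if_pos hy, if_neg fun h2 => ((hYmem y).1 hy).1.2 (hMsmall y h2)] at hyd
    refine h.false_of_low_diamond hX (hd y hy) hyd.symm.le ?_
    intro w hw hwo
    have hwd := hgeq w hw
    rw [if_neg fun hwY => ((hYmem w).1 hwY).1.2 hwo.isSmall, if_neg ?_] at hwd
    · exact hwd.symm.le
    -- A foot is never a middle vertex of these diamonds: the out-neighbours of a middle vertex are
    -- not adjacent, while those of a foot are joined by an arc.
    · intro hwM
      obtain ⟨z, hz, rfl⟩ := Finset.mem_image.1 hwM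
      obtain ⟨s, -, t, -, -, hs, -⟩ := h.exists_two_feet hX (hd z hz)
      have hna := h.sides_not_adj (hd z hz).1 hs
      have hpq := (hd z hz).1.2
      have hym := (hd y hy).1.1.2.1
      have h1 := hpq.2.2.2 _ hwo.2.1
      have h2 := hpq.2.2.2 _ hwo.2.2.1
      have h3 := hwo.1
      grind
  refine ⟨fun v hv => ?_, fun v hv hs => ?_, fun v hv hs => ?_⟩
  · have := hgeq v hv
    rw [if_neg (hYempty v), if_neg] at this
    · exact this.symm
    · intro hvM
      obtain ⟨z, hz, -⟩ := Finset.mem_image.1 hvM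
      exact hYempty z hz
  · have := hfeq v hv
    rw [if_neg (hYempty v)] at this
    simpa only [f, if_pos hs] using this
  · have := hfeq v hv
    rw [if_neg (hYempty v)] at this
    simpa only [f, if_neg hs] using this

/-- A critical set induces a regular tournament on five vertices. -/
lemma critical_regular (h : D.IsP4Free) (hX : D.underlying.CriticalOn X) :
    X.card = 5 ∧ (∀ u ∈ X, ∀ v ∈ X, u ≠ v → D.Adj u v ∨ D.Adj v u) ∧
      ∀ v ∈ X, D.IsSmall v ∧ (D.outIn X v).card = 2 ∧ (D.inIn X v).card = 2 := by
  obtain ⟨hdeg, hsmall, hbig⟩ := h.degrees_eq hX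
  have hclique : ∀ u ∈ X, ∀ v ∈ X, u ≠ v → D.Adj u v ∨ D.Adj v u := fun u hu v hv huv =>
    h.adj_iff.1 (hX.isClique (fun v hv => (hdeg v hv).le) hu hv huv)
  have hne : X.Nonempty := by
    rw [Finset.nonempty_iff_ne_empty]
    rintro rfl
    exact hX.1 (fun _ => 0) (by intro u hu; simp at hu)
  have hcard : X.card = 5 := by
    obtain ⟨v, hv⟩ := hne
    have h1 : D.underlying.nbrsIn X v = X.erase v := by
      ext x
      rw [SimpleGraph.mem_nbrsIn, Finset.mem_erase, and_comm]
      refine and_congr_left fun hx => ⟨fun hvx => hvx.ne.symm, fun hxv => ?_⟩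
      exact h.adj_iff.2 (hclique v hv x hx hxv.symm)
    have h2 := hdeg v hv
    rw [h1, Finset.card_erase_of_mem hv] at h2
    omega
  have hbig1 : ∀ y ∈ D.bigIn X, (D.outIn (D.smallIn X) y).card = 1 ∧
      (D.inIn (D.bigIn X) y).card = 1 := by
    intro y hy
    rw [mem_bigIn] at hy
    have h1 := hbig y hy.1 hy.2
    have h2 := h.card_inIn_bigIn_le (X := X) y
    -- Two small out-neighbours would give a diamond, whose sides are not adjacent, inside a clique.
    have h3 : ¬ 2 ≤ (D.outIn (D.smallIn X) y).card := by
      intro h3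
      obtain ⟨m, p, q, w, hd, hm, hw, hwo⟩ := h.exists_diamond_of_two_le hX hy.2 h3
      have h4 := hd.2.mem_of_two_le (hsmall m hm hd.2.isSmall).ge
      have h5 := h.sides_not_adj hd hwo
      have h6 := hclique p h4.1 q h4.2 hd.2.1
      tauto
    omega
  have hnobig : D.bigIn X = ∅ := by
    rw [Finset.eq_empty_iff_forall_notMem]
    intro y hy
    have hle : (D.bigIn X).card ≤ (D.smallIn X).card := by
      have : ∀ y, ∃ z, y ∈ D.bigIn X → z ∈ D.smallIn X ∧ D.Adj y z := by
        intro y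
        by_cases hy : y ∈ D.bigIn X
        · obtain ⟨z, hz⟩ := Finset.card_pos.1 (by rw [(hbig1 y hy).1]; norm_num :
            0 < (D.outIn (D.smallIn X) y).card)
          exact ⟨z, fun _ => mem_outIn.1 hz⟩
        · exact ⟨y, fun hy' => absurd hy' hy⟩
      choose z hz using this
      refine Finset.card_le_card_of_injOn z (fun y hy => (hz y hy).1) ?_
      intro a ha b hb hab
      have h1 := (hz a ha).2
      rw [hab] at h1
      exact h.big_unique h1 (hz b hb).2 (mem_bigIn.1 ha).2 (mem_bigIn.1 hb).2
    have hsum : (D.smallIn X).card + (D.bigIn X).card = X.card :=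
      Finset.card_filter_add_card_filter_not D.IsSmall
    have hprev : ∀ y ∈ D.bigIn X, ∃ z ∈ D.bigIn X, D.Adj z y := by
      intro y hy
      obtain ⟨z, hz⟩ := Finset.card_pos.1 (by rw [(hbig1 y hy).2]; norm_num :
        0 < (D.inIn (D.bigIn X) y).card)
      exact ⟨z, mem_inIn.1 hz⟩
    obtain ⟨z, hz, hzy⟩ := hprev y hy
    obtain ⟨w, hw, hwz⟩ := hprev z hz
    have n1 : y ≠ z := by rintro rfl; exact h.not_adj_self _ hzy
    have n2 : z ≠ w := by rintro rfl; exact h.not_adj_self _ hwz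
    have n3 : y ≠ w := by rintro rfl; exact h.oriented hzy hwz
    -- Going back twice along big in-neighbours gives three big vertices, hence at least three small
    -- ones by `hle`, too many for five.
    have h3 : 3 ≤ (D.bigIn X).card := by
      rw [← Finset.card_eq_three.2 ⟨y, z, w, n1, n3, n2, rfl⟩]
      refine Finset.card_le_card fun x hx => ?_
      simp only [Finset.mem_insert, Finset.mem_singleton] at hx
      rcases hx with rfl | rfl | rfl <;> assumption
    omega
  refine ⟨hcard, hclique, fun v hv => ?_⟩
  have hs : D.IsSmall v := by
    by_contra hs
    have : v ∈ D.bigIn X := mem_bigIn.2 ⟨hv, hs⟩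
    rw [hnobig] at this
    simp at this
  have h1 := hdeg v hv
  have h2 := hsmall v hv hs
  rw [h.card_nbrsIn] at h1
  exact ⟨hs, h2, by omega⟩

/-- The two in-neighbours of `z` in `X` are joined by an arc, so with `z` they form a transitive
triangle; `outPair_of_triangle` makes `u` an out-twin of its source. -/
lemma exists_twin_of_adj (h : D.IsP4Free) (hX : D.underlying.CriticalOn X) {u z : V}
    (hu : u ∉ X) (hz : z ∈ X) (huz : D.Adj u z) : ∃ v ∈ X, D.Adj v z ∧ D.OutPair u z v := by
  obtain ⟨-, hcl, hreg⟩ := h.critical_regular hX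
  obtain ⟨a, b, hab, hin⟩ := Finset.card_eq_two.1 (hreg z hz).2.2
  have ha : a ∈ X ∧ D.Adj a z := by rw [← mem_inIn, hin]; simp
  have hb : b ∈ X ∧ D.Adj b z := by rw [← mem_inIn, hin]; simp
  have key : ∀ y v, y ∈ X → v ∈ X → D.Adj y z → D.Adj v z → D.Adj y v → D.OutPair u z v := by
    intro y v hy hv hyz hvz hyv
    have hyo : D.OutPair y z v := by
      obtain ⟨c, d, hcd⟩ := (hreg y hy).1
      have h1 := hcd.2.2.2 z hyz
      have h2 := hcd.2.2.2 v hyv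
      have h3 : z ≠ v := by rintro rfl; exact h.not_adj_self _ hvz
      have h4 := hcd.symm
      rcases h1 with rfl | rfl <;> rcases h2 with rfl | rfl
      · exact absurd rfl h3
      · exact hcd
      · exact h4
      · exact absurd rfl h3
    obtain ⟨g, hg⟩ : ∃ g, D.OutPair v z g := by
      obtain ⟨c, d, hcd⟩ := (hreg v hv).1
      rcases hcd.2.2.2 z hvz with rfl | rfl
      · exact ⟨d, hcd⟩
      · exact ⟨c, hcd.symm⟩
    refine h.outPair_of_triangle hyo hg huz (by rintro rfl; exact hu hy)
      (by rintro rfl; exact hu hv) ?_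
    intro hvu
    have := hg.mem_of_two_le (hreg v hv).2.1.ge
    rcases hg.2.2.2 u hvu with rfl | rfl
    · exact hu hz
    · exact hu this.2
  rcases hcl a ha.1 b hb.1 hab with h1 | h1
  · exact ⟨b, hb.1, hb.2, key a b ha.1 hb.1 ha.2 hb.2 h1⟩
  · exact ⟨a, ha.1, ha.2, key b a hb.1 ha.1 hb.2 ha.2 h1⟩

lemma critical_eq_univ (h : D.IsP4Free) (hconn : D.underlying.Connected)
    (hX : D.underlying.CriticalOn X) (v : V) : v ∈ X := by
  obtain ⟨hcard, -, hreg⟩ := h.critical_regular hX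
  by_contra hv
  obtain ⟨x, hx⟩ := Finset.card_pos.1 (by omega : 0 < X.card)
  obtain ⟨w⟩ := hconn.preconnected x v
  obtain ⟨d, -, hd1, hd2⟩ := w.exists_boundary_dart (X : Set V) hx hv
  rw [Finset.mem_coe] at hd1 hd2
  rcases h.adj_iff.1 d.adj with h1 | h1
  · obtain ⟨hs, hout, -⟩ := hreg _ hd1
    obtain ⟨a, b, hab⟩ := hs
    have := hab.mem_of_two_le hout.ge
    rcases hab.2.2.2 _ h1 with h2 | h2
    · exact hd2 (h2 ▸ this.1)
    · exact hd2 (h2 ▸ this.2)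
  -- No arc leaves `X`, so this one enters it. The outer vertex points to just two vertices of `X`;
  -- applying `exists_twin_of_adj` to each arc orients the arc between them both ways.
  · obtain ⟨z, hz, hzd, hdz⟩ := h.exists_twin_of_adj hX hd2 hd1 h1
    obtain ⟨y, hy, hyz, hdy⟩ := h.exists_twin_of_adj hX hd2 hz hdz.2.2.1
    rcases hdy.2.2.2 _ hdz.2.1 with h2 | h2
    · exact hdz.1 h2
    · exact h.oriented hzd (h2 ▸ hyz)

lemma isT5 (h : D.IsP4Free) (hconn : D.underlying.Connected)
    (hcol : ¬ D.underlying.Colorable 4) : D.IsT5 := by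
  obtain ⟨X, hX⟩ := SimpleGraph.exists_criticalOn hcol
  have huniv := h.critical_eq_univ hconn hX
  obtain ⟨hcard, hcl, hreg⟩ := h.critical_regular hX
  refine ⟨?_, ⟨fun x y => h.oriented, ?_⟩, fun u => ⟨?_, ?_⟩⟩
  · rw [← Set.ncard_univ, ← hcard, ← Set.ncard_coe_finset]
    congr 1
    exact (Set.eq_univ_of_forall huniv).symm
  · ext u v
    rw [h.adj_iff, SimpleGraph.top_adj]
    refine ⟨?_, hcl u (huniv u) v (huniv v)⟩
    rintro huv rfl
    exact h.not_adj_self u (huv.elim id id)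
  · have : D.outNeighbors u = (D.outIn X u : Set V) := by
      ext x; simp [outNeighbors, huniv x]
    rw [outDegree, this, Set.encard_coe_eq_coe_finsetCard, (hreg u (huniv u)).2.1]
    rfl
  · have : D.inNeighbors u = (D.inIn X u : Set V) := by
      ext x; simp [inNeighbors, huniv x]
    rw [inDegree, this, Set.encard_coe_eq_coe_finsetCard, (hreg u (huniv u)).2.2]
    rfl

end IsP4Free

end

lemma isP4Free_of_not_containsCopy (hD : D.IsOriented) (hout : ∀ v, 2 ≤ D.outDegree v)
    (hfree : ¬ D.ContainsCopy p4) : D.IsP4Free where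
  oriented := fun {x y} hxy => hD x y hxy
  two_le v := by
    obtain ⟨a, b, ha, hb, hab⟩ := Set.one_lt_encard_iff.1
      (lt_of_lt_of_le (by norm_num) (hout v) : 1 < (D.outNeighbors v).encard)
    exact ⟨a, b, hab, ha, hb⟩
  free := by
    intro x y z v w hyx hyz hvz hvw hyv hxz hwz hxv hwy
    by_contra hxw
    have irr : ∀ u, ¬ D.Adj u u := fun u hu => hD u u hu hu
    refine hfree ⟨![x, y, z, v, w], ?_, ?_⟩
    · rw [← List.nodup_ofFn]
      simp only [List.ofFn_succ, List.ofFn_zero, List.nodup_cons, Matrix.cons_val_zero,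
        Matrix.cons_val_succ, List.mem_cons, List.not_mem_nil, or_false, not_or,
        not_false_eq_true, List.nodup_nil, and_true]
      grind
    · intro a b hab
      simp only [p4, Set.mem_insert_iff, Set.mem_singleton_iff, Prod.mk.injEq] at hab
      rcases hab with ⟨rfl, rfl⟩ | ⟨rfl, rfl⟩ | ⟨rfl, rfl⟩ | ⟨rfl, rfl⟩ <;> assumption

end Digraph

theorem theorem2p1 {V : Type*} (D : Digraph V) (hD : D.IsOriented)
    (hconn : D.underlying.Connected) (hchrom : D.underlying.chromaticNumber = 5)
    (hT5 : ¬ D.IsT5) (hout : ∀ v, 2 ≤ D.outDegree v) :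
    D.ContainsCopy Digraph.p4 := by
  by_contra hfree
  refine hT5 ((Digraph.isP4Free_of_not_containsCopy hD hout hfree).isT5 hconn fun hcol => ?_)
  have := hcol.chromaticNumber_le
  rw [hchrom] at this
  exact absurd this (by norm_num)
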